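/- Let $\mathcal H$ be a finite $k$-uniform hypergraph ($k$-graph) with vertex set $V(\mathcal H)$ and edge set $E(\mathcal H)$. Write $d_{\mathcal H}(x)$ for the number of edges containing $x$ and $\delta$ for the minimum degree. Let $\mathcal H\setminus\{z\}$ denote $\mathcal H$ with the vertex $z$ and all edges containing it deleted, and, for edges $e,e'$, let $\mathcal H\setminus\{e,e'\}$ denote the $k$-graph formed by the remaining edges and the vertices they cover. A monomorphism is an injective map between vertex sets that maps edges to edges. In the strong Ramsey game $\mathcal R^{(k)}(\mathcal H,\aleph_0)$ two players, the first player FP and the second player SP, alternately claim previously unclaimed $k$-element subsets of $\mathbb N$, one per move, FP moving first; the first player whose claimed sets contain all edges of a copy of $\mathcal H$ wins. The game is a draw if neither player has a strategy ensuring that he wins after finitely many moves. A $k$-graph $\mathcal F$ has a fast winning strategy if a player who alternates moves with an opponent on this board can always build a copy of $\mathcal F$ in his first $|E(\mathcal F)|$ moves, regardless of what the opponent builds. (On this infinite board it makes no difference which of the two moves first.) Suppose that $\mathcal H$ satisfies the following. (i) $\mathcal H$ has a vertex $z$ of degree $2$; let $r$ and $g$ be the two edges containing $z$. (ii) $\delta(\mathcal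 H\setminus\{z\})\ge 3$, and $d_{\mathcal H}(u)\ge 4$ for every $u\in V(\mathcal H)\setminus\{z\}$. (iii) $\mathcal H\setminus\{z\}$ has a fast winning strategy. (iv) For every two distinct edges $e,e'\in E(\mathcal H)$, every monomorphism $\phi:V(\mathcal H\setminus\{e,e'\})\to V(\mathcal H)$ is the identity, i.e. $\phi(v)=v$ for all $v\in V(\mathcal H\setminus\{e,e'\})$. (v) $e\cap r\ne\emptyset$ and $e\cap g\neq\emptyset$ for every edge $e\in E(\mathcal H)$. (vi) $|V(\mathcal H)\setminus(r\cup g)|<k-1$. Then $\mathcal R^{(k)}(\mathcal H,\aleph_0)$ is a draw. Moreover, SP has a drawing strategy, that is, a strategy ensuring that FP never wins. -/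

import Mathlib

namespace RamseyGame

/-- A finite `k`-uniform hypergraph (a `k`-graph) with vertices in `V`. -/
structure KGraph (k : ℕ) (V : Type*) where
  verts : Finset V
  edges : Finset (Finset V)
  edge_subset : ∀ e ∈ edges, e ⊆ verts
  uniform : ∀ e ∈ edges, e.card = k

namespace KGraph

variable {k : ℕ} {V W : Type*} [DecidableEq V] [DecidableEq W]

/-- The edges incident with the vertex `x`. -/
def incidentEdges (H : KGraph k V) (x : V) : Finset (Finset V) :=
  H.edges.filter fun e => x ∈ e

/-- The degree of `x`: the number of edges incident with `x`. -/
def degree (H : KGraph k V) (x : V) : ℕ :=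
  (H.incidentEdges x).card

/-- `H ∖ {z}`: delete the vertex `z` together with all edges incident with it. -/
def deleteVertex (H : KGraph k V) (z : V) : KGraph k V where
  verts := H.verts.erase z
  edges := H.edges.filter fun e => z ∉ e
  edge_subset := fun e he x hx => by
    rw [Finset.mem_filter] at he
    exact Finset.mem_erase.2
      ⟨fun h => he.2 (h ▸ hx), H.edge_subset e he.1 hx⟩
  uniform := fun e he => H.uniform e (Finset.mem_filter.1 he).1

/-- `H ∖ S` for a set `S` of edges: the `k`-graph spanned by the edges that are not in `S`.
Its vertices are those lying on at least one remaining edge. -/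
def deleteEdges (H : KGraph k V) (S : Finset (Finset V)) : KGraph k V where
  verts := (H.edges \ S).biUnion id
  edges := H.edges \ S
  edge_subset := fun e he _ hx => Finset.mem_biUnion.2 ⟨e, he, hx⟩
  uniform := fun e he => H.uniform e (Finset.mem_sdiff.1 he).1

/-- `φ` restricts to a monomorphism `V(F) → V(G)`: it is injective on the vertices of `F` and
sends edges of `F` to edges of `G`. The values of `φ` off `V(F)` play no role. -/
def IsMonomorphism (F : KGraph k V) (G : KGraph k W) (φ : V → W) : Prop :=
  (∀ v ∈ F.verts, φ v ∈ G.verts) ∧ Set.InjOn φ F.verts ∧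
    ∀ e ∈ F.edges, e.image φ ∈ G.edges

end KGraph

/-- The board: the edges of the complete `k`-uniform hypergraph on `ℕ`. -/
abbrev BoardEdge (k : ℕ) : Type := {e : Finset ℕ // e.card = k}

/-- The set `A` of board edges contains all edges of some copy of `F`. -/
def ContainsCopy {k : ℕ} {V : Type*} (F : KGraph k V) (A : Set (BoardEdge k)) : Prop :=
  ∃ f : V → ℕ, Set.InjOn f F.verts ∧
    ∀ e ∈ F.edges, ∃ a ∈ A, a.1 = e.image f

inductive Player where
  | first
  | second

/-- The opponent of a player. -/
def Player.other : Player → Player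
  | .first => .second
  | .second => .first

/-- Moves are numbered `0, 1, 2, …`; the first player makes the even-numbered ones. -/
def turn (i : ℕ) : Player :=
  if Even i then .first else .second

/-- An infinite legal sequence of moves: each move claims a previously unclaimed board edge. (The
game is decided by the first completed copy; moves after that have no effect.) -/
def IsPlay {k : ℕ} (p : ℕ → BoardEdge k) : Prop :=
  ∀ i j, i < j → p i ≠ p j

/-- The list of the first `n` moves. -/
def history {k : ℕ} (p : ℕ → BoardEdge k) (n : ℕ) : List (BoardEdge k) :=
  (List.range n).map p

/-- A strategy: given the list of all moves made so far by both players, it names a board edge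
that is still unclaimed. -/
structure Strategy (k : ℕ) where
  move : List (BoardEdge k) → BoardEdge k
  legal : ∀ h, move h ∉ h

/-- In the play `p`, player `P` makes all of his moves according to `s`. -/
def Follows {k : ℕ} (s : Strategy k) (P : Player) (p : ℕ → BoardEdge k) : Prop :=
  ∀ i, turn i = P → p i = s.move (history p i)

/-- The edges claimed by player `P` among the first `n` moves of the play `p`. -/
def claimed {k : ℕ} (P : Player) (p : ℕ → BoardEdge k) (n : ℕ) : Set (BoardEdge k) :=
  {a | ∃ i < n, turn i = P ∧ p i = a}

section Game

variable {k : ℕ} {V : Type*}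

/-- Player `P` wins the play `p` of the strong game `R^(k)(H, ℵ₀)`: after finitely many moves his
edges contain a copy of `H` while those of his opponent do not. -/
def Wins (H : KGraph k V) (P : Player) (p : ℕ → BoardEdge k) : Prop :=
  ∃ n, ContainsCopy H (claimed P p n) ∧ ¬ ContainsCopy H (claimed P.other p n)

/-- `P` has a strategy that ensures his win, in finitely many moves, against every opponent. -/
def HasWinningStrategy (H : KGraph k V) (P : Player) : Prop :=
  ∃ s : Strategy k, ∀ p, IsPlay p → Follows s P p → Wins H P p

/-- `P` has a strategy that ensures that his opponent never wins. -/
def HasDrawingStrategy (H : KGraph k V) (P : Player) : Prop :=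
  ∃ s : Strategy k, ∀ p, IsPlay p → Follows s P p → ¬ Wins H P.other p

/-- The strong game `R^(k)(H, ℵ₀)` is a draw: no player has a winning strategy. -/
def IsDraw (H : KGraph k V) : Prop :=
  ∀ P : Player, ¬ HasWinningStrategy H P

/-- `F` has a fast winning strategy: a player can build a copy of `F` within his first `|E(F)|`
moves, whatever the opponent claims (and regardless of what the opponent builds). The player is
taken to move first. On the infinite board this is equivalent to the version where he moves second:
an extra edge claimed by the opponent, or a missing one, can be moved out of the way. -/
def HasFastWinningStrategy (F : KGraph k V) : Prop :=
  ∃ s : Strategy k, ∀ p, IsPlay p → Follows s .first p →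
    ContainsCopy F (claimed .first p (2 * F.edges.card))

end Game

end RamseyGame

/-! Write m for the number of edges of `H`. SP first builds a copy `f` of `H ∖ {z}` in m - 2 moves,
vertex-disjoint from FP's first edge `e`. FP then holds m - 1 edges and SP is on turn. From here SP
either presses or blocks.

Pressing: SP picks a fresh vertex w and claims the edge `r` of the copy of `H` obtained from `f` by
sending `z` to w. FP must answer with `g` at w, or SP completes `H`. Since w is fresh, a threat
created by that answer must use w as its degree-2 vertex, and the rest of it is a copy χ of `H ∖
{z}` in FP's edges. Provided the traces of `r` and `g` under `f` match those under χ either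
completely or not in the critical way (the field `choice` of `Pressing`), the only missing edge
would be the one SP has just taken. So FP is kept busy forever (`Pressing.step`).

Blocking: if FP threatens a copy ψ of `H`, SP takes the missing edge. By rigidity and the degree
bounds, any later threat of FP is again ψ with `z` moved to some w, completed by the two edges at w
(`Blocked.threat`), and SP can block each of them (`Blocked.block`). Once FP makes no threat, SP
switches to pressing.

It remains to see that one of the two orders (`r` first or `g` first) is suitable for pressing. If
FP had no threat from the start, a copy χ sharing a trace with `f` avoids `e`, since every edge
meets `r` and `g`; it therefore uses all other edges of FP and is unique (`pressing_of_card`). After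
blocking, every χ lies inside the vertex set of ψ, which also contains `e`; the bound on the
vertices outside `r ∪ g` leaves no room for both traces of `f` there (`Blocked.pressing`).

Thus FP never wins. SP has no winning strategy either, by strategy stealing, so the game is a draw.
-/

namespace RamseyGame

/-! ### Plays, histories and the edge sets of the two players. -/

section Plays

variable {k : ℕ}

theorem history_succ (p : ℕ → BoardEdge k) (n : ℕ) :
    history p (n + 1) = history p n ++ [p n] := by
  simp [history, List.range_succ]

theorem length_history (p : ℕ → BoardEdge k) (n : ℕ) : (history p n).length = n := by
  simp [history]

theorem mem_history {p : ℕ → BoardEdge k} {n : ℕ} {a : BoardEdge k} :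
    a ∈ history p n ↔ ∃ i < n, p i = a := by
  simp [history]

theorem isPlay_of_notMem_history {p : ℕ → BoardEdge k} (h : ∀ i, p i ∉ history p i) :
    IsPlay p := fun i j hij he => h j (mem_history.2 ⟨i, hij, he⟩)

theorem IsPlay.notMem_history {p : ℕ → BoardEdge k} (h : IsPlay p) (i : ℕ) :
    p i ∉ history p i := by
  rw [mem_history]
  rintro ⟨j, hj, he⟩
  exact h j i hj he

/-- An increasing chain of positions of unbounded length is the chain of initial segments of a
play. -/
theorem exists_history_eq_of_chain (l : ℕ → List (BoardEdge k))
    (hchain : ∀ n, l n <+: l (n + 1)) (hlen : ∀ n, n ≤ (l n).length) :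
    ∃ p : ℕ → BoardEdge k, ∀ n, history p (l n).length = l n := by
  have hmono : ∀ m n, m ≤ n → l m <+: l n := by
    intro m n hmn
    induction n, hmn using Nat.le_induction with
    | base => exact List.prefix_rfl
    | succ n _ ih => exact ih.trans (hchain n)
  -- Entry i is read off `l (i + 1)`, the first list guaranteed to be long enough.
  refine ⟨fun i => (l (i + 1))[i]'(hlen (i + 1)), fun n => ?_⟩
  apply List.ext_getElem
  · simp [history]
  · intro i h1 h2
    simp only [history, List.getElem_map, List.getElem_range]
    rcases le_total (i + 1) n with h | h
    · exact (hmono _ _ h).getElem _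
    · exact ((hmono _ _ h).getElem _).symm

/-- Every rule that names an unclaimed edge in every position generates a play. -/
theorem exists_play_of_rule (σ : List (BoardEdge k) → BoardEdge k) (hσ : ∀ h, σ h ∉ h) :
    ∃ p : ℕ → BoardEdge k, IsPlay p ∧ ∀ i, p i = σ (history p i) := by
  let l : ℕ → List (BoardEdge k) := fun n => Nat.rec [] (fun _ h => h ++ [σ h]) n
  have hl : ∀ n, l (n + 1) = l n ++ [σ (l n)] := fun n => rfl
  have hlen : ∀ n, (l n).length = n := by
    intro n
    induction n with
    | zero => rfl
    | succ n ih => simp [hl, ih]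
  obtain ⟨p, hp⟩ := exists_history_eq_of_chain l (fun n => by simp [hl]) (fun n => (hlen n).ge)
  have hp' : ∀ n, history p n = l n := fun n => by simpa [hlen] using hp n
  have key : ∀ i, p i = σ (history p i) := by
    intro i
    have h := hp' (i + 1)
    rw [history_succ, hl, ← hp' i] at h
    simpa using h
  exact ⟨p, isPlay_of_notMem_history fun i => by rw [key i]; exact hσ _, key⟩

theorem turn_of_even {i : ℕ} (h : Even i) : turn i = .first := if_pos h

theorem turn_of_odd {i : ℕ} (h : Odd i) : turn i = .second := by
  simp [turn, h]

theorem even_of_turn {i : ℕ} (h : turn i = .first) : Even i := by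
  by_contra hi
  simp [turn, hi] at h

theorem odd_of_turn {i : ℕ} (h : turn i = .second) : Odd i := by
  by_contra hi
  rw [Nat.not_odd_iff_even] at hi
  simp [turn, hi] at h

open Classical in
/-- The edges that `P` holds in the position with move list `h`. -/
noncomputable def side (P : Player) (h : List (BoardEdge k)) : Finset (Finset ℕ) :=
  ((h.zipIdx.filter fun q => turn q.2 = P).map fun q => q.1.1).toFinset

theorem side_nil (P : Player) : side P ([] : List (BoardEdge k)) = ∅ := by
  simp [side]

theorem side_append_of_turn {P : Player} {h : List (BoardEdge k)} {a : BoardEdge k}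
    (ht : turn h.length = P) : side P (h ++ [a]) = insert a.1 (side P h) := by
  ext x
  simp [side, List.zipIdx_append, ht]

theorem side_append_of_turn_ne {P : Player} {h : List (BoardEdge k)} {a : BoardEdge k}
    (ht : turn h.length ≠ P) : side P (h ++ [a]) = side P h := by
  ext x
  simp [side, List.zipIdx_append, ht]

theorem first_ne_second : Player.first ≠ Player.second := nofun

theorem side_first_append_append {h : List (BoardEdge k)} (hh : Even h.length)
    (a b : BoardEdge k) : side .first (h ++ [a] ++ [b]) = insert a.1 (side .first h) := by
  rw [side_append_of_turn_ne, side_append_of_turn (turn_of_even hh)]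
  rw [turn_of_odd (by simpa using hh.add_one)]
  exact first_ne_second.symm

theorem side_second_append_append {h : List (BoardEdge k)} (hh : Even h.length)
    (a b : BoardEdge k) : side .second (h ++ [a] ++ [b]) = insert b.1 (side .second h) := by
  rw [side_append_of_turn, side_append_of_turn_ne]
  · rw [turn_of_even hh]; exact first_ne_second
  · exact turn_of_odd (by simpa using hh.add_one)

theorem mem_side_history {P : Player} {p : ℕ → BoardEdge k} {n : ℕ} {x : Finset ℕ} :
    x ∈ side P (history p n) ↔ ∃ a ∈ claimed P p n, a.1 = x := by
  induction n with
  | zero => simp [history, side_nil, claimed]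
  | succ n ih =>
    rw [history_succ]
    by_cases ht : turn n = P
    · rw [side_append_of_turn (by rwa [length_history]), Finset.mem_insert, ih]
      constructor
      · rintro (rfl | ⟨a, ⟨i, hi, h1, h2⟩, h3⟩)
        · exact ⟨p n, ⟨n, by omega, ht, rfl⟩, rfl⟩
        · exact ⟨a, ⟨i, by omega, h1, h2⟩, h3⟩
      · rintro ⟨a, ⟨i, hi, h1, h2⟩, h3⟩
        rcases Nat.lt_succ_iff_lt_or_eq.1 hi with h | rfl
        · exact Or.inr ⟨a, ⟨i, h, h1, h2⟩, h3⟩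
        · exact Or.inl (by rw [← h3, h2])
    · rw [side_append_of_turn_ne (by rwa [length_history]), ih]
      constructor
      · rintro ⟨a, ⟨i, hi, h1, h2⟩, h3⟩
        exact ⟨a, ⟨i, by omega, h1, h2⟩, h3⟩
      · rintro ⟨a, ⟨i, hi, h1, h2⟩, h3⟩
        rcases Nat.lt_succ_iff_lt_or_eq.1 hi with h | rfl
        · exact ⟨a, ⟨i, h, h1, h2⟩, h3⟩
        · exact absurd h1 ht

theorem mem_side_cases {h : List (BoardEdge k)} {a : BoardEdge k} :
    a ∈ h ↔ a.1 ∈ side .first h ∨ a.1 ∈ side .second h := by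
  induction h using List.reverseRecOn with
  | nil => simp [side_nil]
  | append_singleton h b ih =>
    rw [List.mem_append, ih, List.mem_singleton, Subtype.ext_iff]
    rcases Nat.even_or_odd h.length with he | ho
    · rw [side_append_of_turn (turn_of_even he),
        side_append_of_turn_ne (by rw [turn_of_even he]; exact first_ne_second),
        Finset.mem_insert]
      tauto
    · rw [side_append_of_turn (turn_of_odd ho),
        side_append_of_turn_ne (by rw [turn_of_odd ho]; exact first_ne_second.symm),
        Finset.mem_insert]
      tauto

end Plays

/-! ### Copies of a `k`-graph in a family of edges. -/

section Copies

variable {k : ℕ} {V : Type*}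

/-- `f` embeds `F` into the family `A` of subsets of `ℕ`. -/
def EmbedsVia (F : KGraph k V) (f : V → ℕ) (A : Finset (Finset ℕ)) : Prop :=
  Set.InjOn f F.verts ∧ ∀ e ∈ F.edges, e.image f ∈ A

theorem EmbedsVia.mono {F : KGraph k V} {f : V → ℕ} {A A' : Finset (Finset ℕ)}
    (h : EmbedsVia F f A) (hA : A ⊆ A') : EmbedsVia F f A' :=
  ⟨h.1, fun e he => hA (h.2 e he)⟩

theorem containsCopy_claimed_iff {F : KGraph k V} {P : Player} {p : ℕ → BoardEdge k} {n : ℕ} :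
    ContainsCopy F (claimed P p n) ↔ ∃ f, EmbedsVia F f (side P (history p n)) := by
  unfold ContainsCopy EmbedsVia
  simp only [mem_side_history]

theorem ContainsCopy.mono {F : KGraph k V} {A A' : Set (BoardEdge k)}
    (h : ContainsCopy F A) (hA : A ⊆ A') : ContainsCopy F A' := by
  obtain ⟨f, hf, h⟩ := h
  exact ⟨f, hf, fun e he => let ⟨a, ha, h'⟩ := h e he; ⟨a, hA ha, h'⟩⟩

theorem claimed_mono {P : Player} {p : ℕ → BoardEdge k} {m n : ℕ} (h : m ≤ n) :
    claimed P p m ⊆ claimed P p n := by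
  rintro a ⟨i, hi, h1, h2⟩
  exact ⟨i, by omega, h1, h2⟩

theorem not_wins_both {F : KGraph k V} {P : Player} {p : ℕ → BoardEdge k}
    (h1 : Wins F P p) (h2 : Wins F P.other p) : False := by
  obtain ⟨m, hm, hm'⟩ := h1
  obtain ⟨n, hn, hn'⟩ := h2
  rcases le_total m n with h | h
  · refine hn' ?_
    have : P.other.other = P := by cases P <;> rfl
    rw [this]
    exact hm.mono (claimed_mono h)
  · exact hm' (hn.mono (claimed_mono h))

end Copies

/-! ### Invariants, forcing, and strategy stealing. -/

section Strategies

variable {k : ℕ} {V : Type*}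

open Classical in
/-- The second player can hold a family of positions closed under his turn and his opponent's
reply, so he never loses if no position of the family is lost. -/
theorem hasDrawingStrategy_second_of_invariant (F : KGraph k V) (s : Strategy k)
    (Good : Finset (Finset ℕ) → Finset (Finset ℕ) → Prop)
    (hstart : ∀ a : Finset ℕ, a.card = k → Good {a} ∅)
    (hsafe : ∀ A B, Good A B → (∃ f, EmbedsVia F f A) → ∃ f, EmbedsVia F f B)
    (hstep : ∀ A B, Good A B → ∃ c : Finset ℕ, c.card = k ∧ c ∉ A ∧ c ∉ B ∧
      ∀ b : Finset ℕ, b.card = k → b ∉ A → b ∉ B → b ≠ c → Good (insert b A) (insert c B)) :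
    HasDrawingStrategy F .second := by
  let Q : List (BoardEdge k) → BoardEdge k → Prop := fun h c => c ∉ h ∧
    ∀ b : BoardEdge k, b ∉ h → b ≠ c →
      Good (insert b.1 (side .first h)) (insert c.1 (side .second h))
  let s' : Strategy k :=
    { move := fun h => if hc : ∃ c, Q h c then hc.choose else s.move h
      legal := fun h => by
        split_ifs with hc
        · exact hc.choose_spec.1
        · exact s.legal h }
  refine ⟨s', fun p hp hf => ?_⟩
  have hgood : ∀ n, Good (side .first (history p (2 * n + 1)))
      (side .second (history p (2 * n + 1))) := by
    intro n
    induction n with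
    | zero =>
      rw [history_succ, side_append_of_turn (by simp [history, turn]),
        side_append_of_turn_ne (by simp [history, turn])]
      simpa [history, side_nil] using hstart _ (p 0).2
    | succ n ih =>
      have hQ : ∃ c, Q (history p (2 * n + 1)) c := by
        obtain ⟨c, hc, h1, h2, h3⟩ := hstep _ _ ih
        refine ⟨⟨c, hc⟩, ?_, fun b hb hbc => ?_⟩
        · rw [mem_side_cases]
          tauto
        · rw [mem_side_cases] at hb
          push Not at hb
          exact h3 b.1 b.2 hb.1 hb.2 fun h => hbc (Subtype.ext h)
      have hmove : p (2 * n + 1) = hQ.choose := by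
        rw [hf (2 * n + 1) (turn_of_odd ⟨n, rfl⟩)]
        exact dif_pos hQ
      have hnew := hp.notMem_history (2 * n + 2)
      rw [history_succ, List.mem_append, List.mem_singleton] at hnew
      push Not at hnew
      have := hQ.choose_spec.2 (p (2 * n + 2)) hnew.1 (by rw [← hmove]; exact hnew.2)
      rw [← hmove] at this
      have e : 2 * (n + 1) + 1 = 2 * n + 1 + 1 + 1 := by ring
      have t1 : turn (history p (2 * n + 1)).length = .second := by
        rw [length_history]; exact turn_of_odd ⟨n, rfl⟩
      have t2 : turn (history p (2 * n + 1) ++ [p (2 * n + 1)]).length = .first := by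
        rw [List.length_append, length_history]; exact turn_of_even ⟨n + 1, by simp; ring⟩
      rw [e, history_succ, history_succ, side_append_of_turn t2,
        side_append_of_turn_ne (by rw [t1]; exact first_ne_second.symm),
        side_append_of_turn_ne (by rw [t2]; exact first_ne_second), side_append_of_turn t1]
      exact this
  rintro ⟨n, h1, h2⟩
  have hodd : ∀ m, ContainsCopy F (claimed .first p (2 * m + 1)) →
      ContainsCopy F (claimed .second p (2 * m + 1)) := fun m h => by
    rw [containsCopy_claimed_iff] at h ⊢
    exact hsafe _ _ (hgood m) h
  rcases Nat.even_or_odd' n with ⟨m, rfl | rfl⟩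
  · rcases m with _ | m
    · refine h2 ?_
      convert h1 using 1
      simp [claimed]
    · refine h2 ((hodd m (h1.mono ?_)).mono (claimed_mono (by omega)))
      rintro a ⟨i, hi, ht, ha⟩
      obtain ⟨j, hj⟩ := even_of_turn ht
      exact ⟨i, by omega, ht, ha⟩
  · exact h2 (hodd m h1)

/-- The player holding `B`, on turn, can force the position after `n` rounds to satisfy `T`. -/
def Forces (k : ℕ) (T : Finset (Finset ℕ) → Prop) :
    ℕ → Finset (Finset ℕ) → Finset (Finset ℕ) → Prop
  | 0, _, B => T B
  | n + 1, A, B => ∃ c : Finset ℕ, c.card = k ∧ c ∉ A ∧ c ∉ B ∧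
      ∀ b : Finset ℕ, b.card = k → b ∉ A → b ∉ B → b ≠ c →
        Forces k T n (insert b A) (insert c B)

-- If the outcome could not be forced, the opponent could answer every move so that it remains
-- unforceable. Playing these answers against the given strategy yields a legal play without a copy
-- after the allotted rounds. The forcing form depends only on the two edge sets, which lets moves
-- be transported and combined with other phases.
open Classical in
theorem HasFastWinningStrategy.forces {F : KGraph k V} (h : HasFastWinningStrategy F) :
    Forces k (fun B => ∃ f, EmbedsVia F f B) F.edges.card ∅ ∅ := by
  obtain ⟨s, hs⟩ := h
  set T : Finset (Finset ℕ) → Prop := fun B => ∃ f, EmbedsVia F f B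
  set m := F.edges.card
  by_contra hcon
  -- On the opponent's turn `h` has odd length, and his reply completes round number `h.length / 2 +
  -- 1`.
  let Q : List (BoardEdge k) → BoardEdge k → Prop := fun h b => b ∉ h ∧
    ¬ Forces k T (m - (h.length / 2 + 1)) (side .second (h ++ [b])) (side .first (h ++ [b]))
  let σ : List (BoardEdge k) → BoardEdge k := fun h =>
    if Even h.length then s.move h else if hb : ∃ b, Q h b then hb.choose else s.move h
  have hσ : ∀ h, σ h ∉ h := by
    intro h
    simp only [σ]
    split_ifs with h1 h2
    · exact s.legal h
    · exact h2.choose_spec.1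
    · exact s.legal h
  obtain ⟨p, hp, hpσ⟩ := exists_play_of_rule σ hσ
  have hfol : Follows s .first p := by
    intro i hi
    rw [hpσ i]
    simp [σ, length_history, even_of_turn hi]
  have hall : ∀ i ≤ m, ¬ Forces k T (m - i) (side .second (history p (2 * i)))
      (side .first (history p (2 * i))) := by
    intro i
    induction i with
    | zero => intro _; simpa [history, side_nil] using hcon
    | succ i ih =>
      intro hi
      have hev : Even (history p (2 * i)).length := by simp [length_history]
      obtain ⟨n, hn⟩ : ∃ n, m - i = n + 1 := ⟨m - i - 1, by omega⟩
      have ih := ih (by omega)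
      rw [hn] at ih
      unfold Forces at ih
      push Not at ih
      have hnew := hp.notMem_history (2 * i)
      rw [mem_side_cases] at hnew
      push Not at hnew
      obtain ⟨b, hb, h1, h2, h3, h4⟩ := ih (p (2 * i)).1 (p (2 * i)).2 hnew.2 hnew.1
      have hsA : ∀ b, side .second (history p (2 * i) ++ [p (2 * i)] ++ [b]) =
          insert b.1 (side .second (history p (2 * i))) := fun b =>
        side_second_append_append hev _ b
      have hsB : ∀ b, side .first (history p (2 * i) ++ [p (2 * i)] ++ [b]) =
          insert (p (2 * i)).1 (side .first (history p (2 * i))) := fun b =>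
        side_first_append_append hev _ b
      have hQ : ∃ b, Q (history p (2 * i + 1)) b := by
        refine ⟨⟨b, hb⟩, ?_, ?_⟩
        · rw [history_succ, List.mem_append, mem_side_cases, List.mem_singleton, Subtype.ext_iff]
          tauto
        · have : m - ((history p (2 * i + 1)).length / 2 + 1) = n := by
            rw [length_history]; omega
          rw [this, history_succ, hsA, hsB]
          exact h4
      have hmove : p (2 * i + 1) = hQ.choose := by
        rw [hpσ (2 * i + 1)]
        have : ¬ Even (history p (2 * i + 1)).length := by simp [length_history]
        simp only [σ]
        rw [if_neg this, dif_pos hQ]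
      have := hQ.choose_spec.2
      rw [← hmove, ← history_succ, length_history] at this
      have e1 : (2 * i + 1) / 2 + 1 = i + 1 := by omega
      rwa [e1] at this
  have h0 := hall m le_rfl
  rw [Nat.sub_self] at h0
  exact h0 (containsCopy_claimed_iff.1 (hs p hp hfol))

theorem exists_notMem_of_finite (S : Finset (Finset ℕ)) (T : Finset ℕ) :
    ∃ x, x ∉ T ∧ ∀ a ∈ S, x ∉ a := by
  obtain ⟨x, hx⟩ := Infinite.exists_notMem_finset (T ∪ S.biUnion id)
  rw [Finset.mem_union, Finset.mem_biUnion] at hx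
  push Not at hx
  exact ⟨x, hx.1, fun a ha => hx.2 a ha⟩

theorem exists_card_eq_notMem (hk : k ≠ 0) (S : Finset (Finset ℕ)) :
    ∃ a : Finset ℕ, a.card = k ∧ a ∉ S := by
  obtain ⟨x, -, hx⟩ := exists_notMem_of_finite S ∅
  refine ⟨Finset.Ico x (x + k), by simp, fun h => hx _ h ?_⟩
  simp
  omega

/-- A forced outcome can be forced inside the image of an injection `ι`: moves of the opponent
outside the image are replaced by arbitrary ones. -/
theorem Forces.image {T : Finset (Finset ℕ) → Prop} (hk : k ≠ 0) {ι : ℕ → ℕ}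
    (hι : Function.Injective ι) {n : ℕ} {A A' B : Finset (Finset ℕ)} (h : Forces k T n A B)
    (hA : ∀ x : Finset ℕ, x.image ι ∈ A' → x ∈ A) :
    Forces k (fun C => ∃ B, T B ∧ C = B.image (Finset.image ι)) n A'
      (B.image (Finset.image ι)) := by
  have hinj : Function.Injective (Finset.image ι) := Finset.image_injective hι
  induction n generalizing A A' B with
  | zero => exact ⟨B, h, rfl⟩
  | succ n ih =>
    obtain ⟨c, hc, hcA, hcB, hstep⟩ := h
    refine ⟨c.image ι, by rw [Finset.card_image_of_injective _ hι, hc], fun h => hcA (hA _ h),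
      by rwa [hinj.mem_finset_image], fun b hb hbA hbB hbc => ?_⟩
    rw [← Finset.image_insert]
    -- If `b` has no unused preimage, the simulated opponent makes a dummy move. Later real moves
    -- may hit dummies, which is why only one direction of the correspondence between `A` and `A'`
    -- is maintained.
    by_cases hex : ∃ b' : Finset ℕ, b'.image ι = b ∧ b' ∉ A
    · obtain ⟨b', rfl, hb'⟩ := hex
      refine ih (hstep b' ?_ hb' ?_ ?_) ?_
      · rwa [Finset.card_image_of_injective _ hι] at hb
      · exact fun h => hbB (Finset.mem_image_of_mem _ h)
      · exact fun h => hbc (by rw [h])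
      · intro x hx
        rw [Finset.mem_insert] at hx ⊢
        exact hx.imp (fun h => hinj h) (hA x)
    · push Not at hex
      obtain ⟨b', hb', hnew⟩ := exists_card_eq_notMem hk (A ∪ insert c B)
      rw [Finset.mem_union, Finset.mem_insert] at hnew
      push Not at hnew
      refine ih (hstep b' hb' hnew.1 hnew.2.2 hnew.2.1) ?_
      intro x hx
      rw [Finset.mem_insert] at hx ⊢
      exact Or.inr (hx.elim (hex x) (hA x))

theorem not_hasWinningStrategy_of_hasDrawingStrategy {F : KGraph k V}
    (h : HasDrawingStrategy F .second) : ¬ HasWinningStrategy F .first := by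
  rintro ⟨s, hs⟩
  obtain ⟨s', hs'⟩ := h
  obtain ⟨p, hp, hpσ⟩ := exists_play_of_rule
    (fun h => if Even h.length then s.move h else s'.move h) (fun h => by
      split_ifs
      · exact s.legal h
      · exact s'.legal h)
  refine hs' p hp (fun i hi => ?_) (hs p hp fun i hi => ?_)
  · have := odd_of_turn hi
    rw [hpσ i, length_history, if_neg (by simpa using this)]
  · rw [hpσ i, length_history, if_pos (even_of_turn hi)]

open Classical in
/-- One round of two coupled games in which the strategy `s` plays as second player: its move in
the left game is repeated as the first player's move in the right game, and its answer there is
repeated in the left game, where a replacement is used if that edge is already taken. -/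
noncomputable def coupledStep (s : Strategy k) (q : List (BoardEdge k) × List (BoardEdge k)) :
    List (BoardEdge k) × List (BoardEdge k) :=
  let b := s.move q.1
  let c := s.move (q.2 ++ [b])
  (q.1 ++ [b] ++ [if c ∈ q.1 ++ [b] then s.move (q.1 ++ [b]) else c], q.2 ++ [b] ++ [c])

/-- Strategy stealing. -/
theorem not_hasWinningStrategy_second (F : KGraph k V) : ¬ HasWinningStrategy F .second := by
  rintro ⟨s, hs⟩
  -- The left game opens with an arbitrary extra edge of its first player, which can only help him.
  let q : ℕ → List (BoardEdge k) × List (BoardEdge k) :=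
    fun n => (coupledStep s)^[n] ([s.move []], [])
  have hq : ∀ n, q (n + 1) = coupledStep s (q n) := fun n => Function.iterate_succ_apply' _ _ _
  have hl1 : ∀ n, (q n).1.length = 2 * n + 1 := by
    intro n
    induction n with
    | zero => rfl
    | succ n ih => simp [hq, coupledStep, ih]; ring
  have hl2 : ∀ n, (q n).2.length = 2 * n := by
    intro n
    induction n with
    | zero => rfl
    | succ n ih => simp [hq, coupledStep, ih]; ring
  obtain ⟨p₁, hp₁⟩ := exists_history_eq_of_chain (fun n => (q n).1)
    (fun n => by simp [hq, coupledStep]) (fun n => by simp only [hl1]; omega)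
  obtain ⟨p₂, hp₂⟩ := exists_history_eq_of_chain (fun n => (q n).2)
    (fun n => by simp [hq, coupledStep]) (fun n => by simp only [hl2]; omega)
  simp only [hl1] at hp₁
  simp only [hl2] at hp₂
  have hstep₁ : ∀ n, p₁ (2 * n + 1) = s.move (history p₁ (2 * n + 1)) ∧
      p₁ (2 * n + 2) = (coupledStep s (q n)).1.getLast (by simp [coupledStep]) := by
    intro n
    have h := hp₁ (n + 1)
    rw [show 2 * (n + 1) + 1 = 2 * n + 1 + 1 + 1 by ring, history_succ, history_succ, hq] at h
    have h' : (history p₁ (2 * n + 1) ++ [p₁ (2 * n + 1)]) ++ [p₁ (2 * n + 2)] =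
      (coupledStep s (q n)).1 := h
    refine ⟨?_, by simp [← h']⟩
    simp only [coupledStep, ← hp₁ n] at h'
    have h'' := List.append_inj_left' h' (by simp)
    simpa using h''
  have hstep₂ : ∀ n, p₂ (2 * n) = p₁ (2 * n + 1) ∧
      p₂ (2 * n + 1) = s.move (history p₂ (2 * n + 1)) := by
    intro n
    have h := hp₂ (n + 1)
    rw [show 2 * (n + 1) = 2 * n + 1 + 1 by ring, history_succ, history_succ, hq] at h
    simp only [coupledStep, ← hp₂ n, ← hp₁ n, ← (hstep₁ n).1] at h
    have h0 : p₂ (2 * n) = p₁ (2 * n + 1) := by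
      have h'' := List.append_inj_left' h (by simp)
      simpa using h''
    refine ⟨h0, ?_⟩
    have h'' := List.append_inj_right' h (by simp)
    rw [List.singleton_inj] at h''
    rw [h'', history_succ, h0]
  have hinv : ∀ n, side .second (q n).1 = side .first (q n).2 ∧
      side .second (q n).2 ⊆ side .first (q n).1 := by
    intro n
    induction n with
    | zero =>
      have e : side .second ([] ++ [s.move []]) = side .second ([] : List (BoardEdge k)) :=
        side_append_of_turn_ne (by simp [turn])
      rw [side_nil] at e
      have e' : side .second [s.move []] = ∅ := e
      simp [q, side_nil, e']
    | succ n ih =>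
      obtain ⟨ih1, ih2⟩ := ih
      have t1 : turn (q n).1.length = .second := by rw [hl1]; exact turn_of_odd ⟨n, rfl⟩
      have t2 : ∀ b, turn ((q n).1 ++ [b]).length = .first := fun b => by
        rw [List.length_append, hl1]; exact turn_of_even ⟨n + 1, by simp; ring⟩
      have hev : Even (q n).2.length := by rw [hl2]; exact even_two_mul n
      have hleg := s.legal ((q n).2 ++ [s.move (q n).1])
      rw [hq]
      simp only [coupledStep]
      rw [side_second_append_append hev, side_first_append_append hev,
        side_append_of_turn_ne (by rw [t2]; exact first_ne_second), side_append_of_turn t1,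
        side_append_of_turn (t2 _),
        side_append_of_turn_ne (by rw [t1]; exact first_ne_second.symm), ih1]
      refine ⟨rfl, Finset.insert_subset ?_ (ih2.trans (Finset.subset_insert _ _))⟩
      rw [Finset.mem_insert]
      -- If the answer is already taken on the left, legality on the right excludes the left second
      -- player, who holds the same edges as the right first player. So the left first player owns
      -- it already.
      split_ifs with hmem
      · right
        rw [List.mem_append, mem_side_cases, ih1] at hmem
        rw [List.mem_append, mem_side_cases] at hleg
        tauto
      · exact Or.inl rfl
  have hmem : ∀ n a, a ∈ (q n).2 → a ∈ (q n).1 := by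
    intro n a ha
    rw [mem_side_cases] at ha ⊢
    rw [(hinv n).1]
    exact ha.symm.imp (fun h => (hinv n).2 h) id
  have hplay₁ : IsPlay p₁ := by
    refine isPlay_of_notMem_history fun i => ?_
    rcases Nat.even_or_odd' i with ⟨n, rfl | rfl⟩
    · rcases n with _ | n
      · simp [history]
      · rw [show 2 * (n + 1) = 2 * n + 1 + 1 by ring, history_succ, (hstep₁ n).2, (hstep₁ n).1,
          hp₁ n]
        simp only [coupledStep, List.getLast_append_singleton]
        split_ifs with h
        · exact s.legal _
        · exact h
    · rw [(hstep₁ n).1]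
      exact s.legal _
  have hplay₂ : IsPlay p₂ := by
    refine isPlay_of_notMem_history fun i => ?_
    rcases Nat.even_or_odd' i with ⟨n, rfl | rfl⟩
    · rw [(hstep₂ n).1, hp₂ n]
      intro h
      have := hmem n _ h
      rw [← hp₁ n] at this
      exact hplay₁.notMem_history _ this
    · rw [(hstep₂ n).2]
      exact s.legal _
  have hwin₁ := hs p₁ hplay₁ fun i hi => by
    obtain ⟨n, rfl⟩ := odd_of_turn hi
    exact (hstep₁ n).1
  obtain ⟨N, hN, hN'⟩ := hs p₂ hplay₂ fun i hi => by
    obtain ⟨n, rfl⟩ := odd_of_turn hi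
    exact (hstep₂ n).2
  obtain ⟨n, hn, hn'⟩ : ∃ n, ContainsCopy F (claimed .second p₂ (2 * n)) ∧
      ¬ ContainsCopy F (claimed .first p₂ (2 * n)) := by
    -- Rounding `N` down to an even time loses no move of the second player, who moves at odd times.
    refine ⟨N / 2, hN.mono ?_, fun h => hN' (h.mono (claimed_mono (by omega)))⟩
    rintro a ⟨i, hi, ht, ha⟩
    obtain ⟨j, hj⟩ := odd_of_turn ht
    exact ⟨i, by omega, ht, ha⟩
  refine not_wins_both (P := .first) ⟨2 * n + 1, ?_, ?_⟩ hwin₁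
  · rw [containsCopy_claimed_iff, hp₂] at hn
    rw [containsCopy_claimed_iff, hp₁]
    exact hn.imp fun f hf => hf.mono (hinv n).2
  · rw [containsCopy_claimed_iff, hp₂, ← (hinv n).1, ← hp₁, ← containsCopy_claimed_iff] at hn'
    exact hn'

end Strategies

end RamseyGame

namespace RamseyGame

open Finset

/-! ### Degree and edge counts for embeddings, and moving a single vertex. -/

section Embeddings

variable {k : ℕ} {V : Type*}

theorem mem_image_iff_of_injOn {S e : Finset V} {f : V → ℕ} (hf : Set.InjOn f S) (he : e ⊆ S)
    {v : V} (hv : v ∈ S) : f v ∈ e.image f ↔ v ∈ e := by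
  refine ⟨fun h => ?_, fun h => mem_image_of_mem _ h⟩
  obtain ⟨u, hu, huv⟩ := mem_image.1 h
  rwa [← hf (he hu) hv huv]

theorem eq_of_image_eq_of_injOn {S e e' : Finset V} {f : V → ℕ} (hf : Set.InjOn f S)
    (he : e ⊆ S) (he' : e' ⊆ S) (h : e.image f = e'.image f) : e = e' := by
  ext v
  constructor
  · intro hv
    rw [← mem_image_iff_of_injOn hf he' (he hv), ← h]
    exact mem_image_of_mem _ hv
  · intro hv
    rw [← mem_image_iff_of_injOn hf he (he' hv), h]
    exact mem_image_of_mem _ hv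

theorem KGraph.image_injOn (F : KGraph k V) {f : V → ℕ} (hf : Set.InjOn f F.verts) :
    Set.InjOn (fun e : Finset V => e.image f) F.edges := fun _ he _ he' h =>
  eq_of_image_eq_of_injOn hf (F.edge_subset _ he) (F.edge_subset _ he') h

theorem EmbedsVia.card_le {F : KGraph k V} {f : V → ℕ} {A : Finset (Finset ℕ)}
    (h : EmbedsVia F f A) : F.edges.card ≤ A.card :=
  card_le_card_of_injOn (fun e => e.image f) (fun e he => h.2 e he) (F.image_injOn h.1)

theorem EmbedsVia.exists_eq_of_card_le {F : KGraph k V} {f : V → ℕ} {A : Finset (Finset ℕ)}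
    (h : EmbedsVia F f A) (hA : A.card ≤ F.edges.card) {a : Finset ℕ} (ha : a ∈ A) :
    ∃ e ∈ F.edges, e.image f = a := by
  have : F.edges.image (fun e => e.image f) = A := by
    apply eq_of_subset_of_card_le
    · intro x hx
      obtain ⟨e, he, rfl⟩ := mem_image.1 hx
      exact h.2 e he
    · rwa [card_image_of_injOn (F.image_injOn h.1)]
  rw [← this] at ha
  exact mem_image.1 ha

variable [DecidableEq V]

theorem EmbedsVia.degree_le {F : KGraph k V} {f : V → ℕ} {A : Finset (Finset ℕ)}
    (h : EmbedsVia F f A) (v : V) :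
    F.degree v ≤ (A.filter fun a => f v ∈ a).card := by
  refine card_le_card_of_injOn (fun e => e.image f) (fun e he => ?_) ?_
  · have he' := mem_filter.1 he
    exact mem_filter.2 ⟨h.2 e he'.1, mem_image_of_mem _ he'.2⟩
  · exact (F.image_injOn h.1).mono fun e he => (mem_filter.1 he).1

theorem image_update_of_notMem {f : V → ℕ} {z : V} {w : ℕ} {e : Finset V} (h : z ∉ e) :
    e.image (Function.update f z w) = e.image f :=
  image_congr fun v hv => Function.update_of_ne (fun h' => h (by rwa [← h'])) _ _

theorem image_update_of_mem {f : V → ℕ} {z : V} {w : ℕ} {e : Finset V} (h : z ∈ e) :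
    e.image (Function.update f z w) = insert w ((e.erase z).image f) := by
  conv_lhs => rw [← insert_erase h]
  rw [image_insert, Function.update_self, image_update_of_notMem (notMem_erase z e)]

theorem injOn_update {f : V → ℕ} {S : Finset V} {z : V} {w : ℕ}
    (hf : Set.InjOn f (S.erase z : Finset V)) (hw : w ∉ (S.erase z).image f) :
    Set.InjOn (Function.update f z w) S := by
  intro u hu v hv h
  by_cases huz : u = z
  · by_cases hvz : v = z
    · rw [huz, hvz]
    · rw [huz, Function.update_self, Function.update_of_ne hvz] at h
      exact absurd (h ▸ mem_image_of_mem f (mem_erase.2 ⟨hvz, hv⟩)) hw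
  · by_cases hvz : v = z
    · rw [hvz, Function.update_self, Function.update_of_ne huz] at h
      exact absurd (h ▸ mem_image_of_mem f (mem_erase.2 ⟨huz, hu⟩)) hw
    · rw [Function.update_of_ne huz, Function.update_of_ne hvz] at h
      exact hf (mem_coe.2 (mem_erase.2 ⟨huz, hu⟩)) (mem_coe.2 (mem_erase.2 ⟨hvz, hv⟩)) h

end Embeddings

/-! ### Rigidity around the pivot, and the blocking phase. -/

section Pivot

variable {k : ℕ} {V : Type*} [DecidableEq V]

/-- The structural hypotheses on a `k`-graph `H` whose vertex `z` lies on exactly the two edges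
`r` and `g`. -/
structure IsPivot (H : KGraph k V) (z : V) (r g : Finset V) : Prop where
  mem : z ∈ H.verts
  r_mem : r ∈ H.edges
  g_mem : g ∈ H.edges
  ne : r ≠ g
  z_mem_r : z ∈ r
  z_mem_g : z ∈ g
  eq_or : ∀ e ∈ H.edges, z ∈ e → e = r ∨ e = g
  three_le : ∀ u ∈ H.verts, u ≠ z → 3 ≤ (H.deleteVertex z).degree u
  four_le : ∀ u ∈ H.verts, u ≠ z → 4 ≤ H.degree u
  rigid : ∀ e ∈ H.edges, ∀ e' ∈ H.edges, e ≠ e' → ∀ φ : V → V,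
    (H.deleteEdges {e, e'}).IsMonomorphism H φ →
      ∀ v ∈ (H.deleteEdges {e, e'}).verts, φ v = v
  meet : ∀ e ∈ H.edges, (e ∩ r).Nonempty ∧ (e ∩ g).Nonempty
  small : (H.verts \ (r ∪ g)).card < k - 1

variable {H : KGraph k V} {z : V} {r g : Finset V}

theorem IsPivot.swap (hH : IsPivot H z r g) : IsPivot H z g r where
  mem := hH.mem
  r_mem := hH.g_mem
  g_mem := hH.r_mem
  ne := hH.ne.symm
  z_mem_r := hH.z_mem_g
  z_mem_g := hH.z_mem_r
  eq_or := fun e he hz => (hH.eq_or e he hz).symm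
  three_le := hH.three_le
  four_le := hH.four_le
  rigid := hH.rigid
  meet := fun e he => (hH.meet e he).symm
  small := by rw [union_comm]; exact hH.small

namespace IsPivot

theorem mem_deleteVertex {e : Finset V} :
    e ∈ (H.deleteVertex z).edges ↔ e ∈ H.edges ∧ z ∉ e := by
  simp [KGraph.deleteVertex]

theorem card_deleteVertex (hH : IsPivot H z r g) :
    (H.deleteVertex z).edges.card + 2 = H.edges.card := by
  have h1 : H.edges.filter (fun e => z ∈ e) = {r, g} := by
    ext e
    rw [mem_filter, mem_insert, mem_singleton]
    constructor
    · exact fun h => hH.eq_or e h.1 h.2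
    · rintro (rfl | rfl)
      · exact ⟨hH.r_mem, hH.z_mem_r⟩
      · exact ⟨hH.g_mem, hH.z_mem_g⟩
  have h2 := card_filter_add_card_filter_not (s := H.edges) (fun e => z ∈ e)
  rw [h1, card_pair hH.ne] at h2
  change (H.edges.filter fun e => z ∉ e).card + 2 = _
  omega

/-- Two embeddings of `H` agree off `z` if the first maps all but two edges to edges of the
image of the second. -/
theorem eq_of_image_mem (hH : IsPivot H z r g) {θ ψ : V → ℕ} (hθ : Set.InjOn θ H.verts)
    (hψ : Set.InjOn ψ H.verts) {e e' : Finset V} (he : e ∈ H.edges) (he' : e' ∈ H.edges)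
    (hne : e ≠ e')
    (h : ∀ x ∈ H.edges, x ≠ e → x ≠ e' → ∃ y ∈ H.edges, x.image θ = y.image ψ)
    {v : V} (hv : v ∈ H.verts) (hvz : v ≠ z) : θ v = ψ v := by
  have hne' : Nonempty V := ⟨z⟩
  -- The transition map ψ⁻¹ ∘ θ is a monomorphism on `H` minus two edges, so rigidity makes it the
  -- identity.
  set φ : V → V := fun u => Function.invFunOn ψ H.verts (θ u)
  have hedge : ∀ x, x ∈ (H.deleteEdges {e, e'}).edges ↔ x ∈ H.edges ∧ x ≠ e ∧ x ≠ e' := by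
    intro x
    simp [KGraph.deleteEdges]
  have hsub : ∀ u ∈ (H.deleteEdges {e, e'}).verts,
      ∃ x ∈ H.edges, x ≠ e ∧ x ≠ e' ∧ u ∈ x := by
    intro u hu
    obtain ⟨x, hx, hux⟩ := mem_biUnion.1 hu
    obtain ⟨h1, h2, h3⟩ := (hedge x).1 hx
    exact ⟨x, h1, h2, h3, hux⟩
  have himg : ∀ u ∈ (H.deleteEdges {e, e'}).verts, θ u ∈ ψ '' H.verts := by
    intro u hu
    obtain ⟨x, hx, h1, h2, hux⟩ := hsub u hu
    obtain ⟨y, hy, hxy⟩ := h x hx h1 h2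
    have : θ u ∈ y.image ψ := hxy ▸ mem_image_of_mem _ hux
    obtain ⟨w, hw, hwu⟩ := mem_image.1 this
    exact ⟨w, H.edge_subset y hy hw, hwu⟩
  have hφ : ∀ u ∈ (H.deleteEdges {e, e'}).verts, ψ (φ u) = θ u := fun u hu =>
    Function.invFunOn_eq (himg u hu)
  have hφm : ∀ u ∈ (H.deleteEdges {e, e'}).verts, φ u ∈ H.verts := fun u hu =>
    Function.invFunOn_mem (himg u hu)
  have hmono : (H.deleteEdges {e, e'}).IsMonomorphism H φ := by
    refine ⟨hφm, ?_, ?_⟩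
    · intro u hu u' hu' huu'
      have hu1 : u ∈ H.verts := by
        obtain ⟨x, hx, -, -, hux⟩ := hsub u hu
        exact H.edge_subset x hx hux
      have hu2 : u' ∈ H.verts := by
        obtain ⟨x, hx, -, -, hux⟩ := hsub u' hu'
        exact H.edge_subset x hx hux
      apply hθ hu1 hu2
      rw [← hφ u hu, ← hφ u' hu', huu']
    · intro x hx
      obtain ⟨h1, h2, h3⟩ := (hedge x).1 hx
      obtain ⟨y, hy, hxy⟩ := h x h1 h2 h3
      have hxv : x ⊆ (H.deleteEdges {e, e'}).verts := KGraph.edge_subset _ x hx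
      have : x.image φ = y := by
        apply eq_of_image_eq_of_injOn hψ _ (H.edge_subset y hy)
        · rw [image_image, ← hxy]
          exact image_congr fun u hu => hφ u (hxv hu)
        · intro u hu
          obtain ⟨u', hu', rfl⟩ := mem_image.1 hu
          exact hφm _ (hxv hu')
      rwa [this]
  -- A vertex of degree at least 4 still lies on an edge after two are removed.
  have hvmem : v ∈ (H.deleteEdges {e, e'}).verts := by
    have hd : ((H.incidentEdges v) \ {e, e'}).Nonempty := by
      rw [← card_pos]
      have h1 := le_card_sdiff {e, e'} (H.incidentEdges v)
      have h2 : ({e, e'} : Finset (Finset V)).card ≤ 2 := card_le_two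
      have h3 : 4 ≤ (H.incidentEdges v).card := hH.four_le v hv hvz
      omega
    obtain ⟨x, hx⟩ := hd
    obtain ⟨hx1, hx2⟩ := mem_sdiff.1 hx
    obtain ⟨hx3, hx4⟩ := mem_filter.1 hx1
    exact mem_biUnion.2 ⟨x, mem_sdiff.2 ⟨hx3, hx2⟩, hx4⟩
  rw [← hφ v hvmem, hH.rigid e he e' he' hne φ hmono v hvmem]

/-- Values of `ψ` off the pivot. -/
abbrev base (H : KGraph k V) (z : V) (ψ : V → ℕ) : Finset ℕ := (H.verts.erase z).image ψ

theorem eq_of_mem_image_update {ψ : V → ℕ} {w w' : ℕ} {x : Finset V} (hx : x ∈ H.edges)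
    (hw : w ∉ base H z ψ) (h : w ∈ x.image (Function.update ψ z w')) : w' = w ∧ z ∈ x := by
  obtain ⟨v, hv, hvw⟩ := mem_image.1 h
  by_cases hvz : v = z
  · subst hvz
    rw [Function.update_self] at hvw
    exact ⟨hvw, hv⟩
  · rw [Function.update_of_ne hvz] at hvw
    exact absurd (hvw ▸ mem_image_of_mem ψ (mem_erase.2 ⟨hvz, H.edge_subset x hx hv⟩)) hw

theorem mem_image_update {ψ : V → ℕ} {w : ℕ} {x : Finset V} (h : z ∈ x) :
    w ∈ x.image (Function.update ψ z w) := by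
  rw [image_update_of_mem h]
  exact mem_insert_self _ _

/-- The opponent's edges `A` come from the family of embeddings `update ψ z w`; every threat he
may have had is already blocked by an edge of `B`. -/
structure Blocked (H : KGraph k V) (z : V) (r g : Finset V) (ψ : V → ℕ)
    (A B : Finset (Finset ℕ)) : Prop where
  inj : Set.InjOn ψ H.verts
  subset : ∀ a ∈ A, ∃ w ∉ base H z ψ, ∃ x ∈ H.edges, a = x.image (Function.update ψ z w)
  hit : ∀ w ∉ base H z ψ, (∃ x ∈ H.edges, x.image (Function.update ψ z w) ∈ B) ∨
    (r.image (Function.update ψ z w) ∉ A ∧ g.image (Function.update ψ z w) ∉ A)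
  single : (∀ w ∉ base H z ψ, r.image (Function.update ψ z w) ∈ A →
      g.image (Function.update ψ z w) ∉ A) ∨
    ((∀ a ∈ A, ∃ x ∈ H.edges, a = x.image ψ) ∧
      ∀ w ∉ base H z ψ, ∃ x ∈ H.edges, x.image (Function.update ψ z w) ∈ B)

variable {ψ : V → ℕ} {A B : Finset (Finset ℕ)}

theorem notMem_base (hH : IsPivot H z r g) (hψ : Set.InjOn ψ H.verts) : ψ z ∉ base H z ψ := by
  intro h
  obtain ⟨v, hv, hvz⟩ := mem_image.1 h
  exact (mem_erase.1 hv).1 (hψ (mem_erase.1 hv).2 hH.mem hvz)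

theorem Blocked.injOn_update (h : Blocked H z r g ψ A B) {w : ℕ} (hw : w ∉ base H z ψ) :
    Set.InjOn (Function.update ψ z w) H.verts :=
  RamseyGame.injOn_update (h.inj.mono (coe_subset.2 (erase_subset _ _))) hw

theorem Blocked.eq_or_of_mem (hH : IsPivot H z r g) (h : Blocked H z r g ψ A B) {w : ℕ}
    (hw : w ∉ base H z ψ) {a : Finset ℕ} (ha : a ∈ A) (hwa : w ∈ a) :
    a = r.image (Function.update ψ z w) ∨ a = g.image (Function.update ψ z w) := by
  obtain ⟨w', -, x, hx, rfl⟩ := h.subset a ha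
  obtain ⟨rfl, hzx⟩ := eq_of_mem_image_update hx hw hwa
  rcases hH.eq_or x hx hzx with rfl | rfl
  · exact Or.inl rfl
  · exact Or.inr rfl

theorem Blocked.card_filter_le_one (hH : IsPivot H z r g) (h : Blocked H z r g ψ A B) {w : ℕ}
    (hw : w ∉ base H z ψ) (hs : r.image (Function.update ψ z w) ∈ A →
      g.image (Function.update ψ z w) ∉ A) : (A.filter fun a => w ∈ a).card ≤ 1 := by
  rw [card_le_one]
  intro a ha b hb
  rw [mem_filter] at ha hb
  rcases h.eq_or_of_mem hH hw ha.1 ha.2 with rfl | rfl <;>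
    rcases h.eq_or_of_mem hH hw hb.1 hb.2 with rfl | rfl
  · rfl
  · exact absurd hb.1 (hs ha.1)
  · exact absurd ha.1 (hs hb.1)
  · rfl

theorem card_filter_insert_le (A : Finset (Finset ℕ)) (a : Finset ℕ) (w : ℕ) :
    ((insert a A).filter fun x => w ∈ x).card ≤ (A.filter fun x => w ∈ x).card + 1 := by
  rw [filter_insert]
  split_ifs
  · exact card_insert_le _ _
  · omega

/-- The edges of `A` used by a copy of `H` in `A` and two more edges lie in a single
`update ψ z w`. -/
theorem Blocked.exists_center (hH : IsPivot H z r g) (h : Blocked H z r g ψ A B)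
    {θ : V → ℕ} {a t : Finset ℕ} (hθ : EmbedsVia H θ (insert t (insert a A))) :
    ∃ w ∉ base H z ψ, ∀ x ∈ H.edges, x.image θ ∈ A →
      ∃ y ∈ H.edges, x.image θ = y.image (Function.update ψ z w) := by
  rcases h.single with hs | ⟨hs, -⟩
  · have hcenter : ∀ w ∉ base H z ψ, ∀ x ∈ H.edges, w ∈ x.image θ → w = θ z := by
      intro w hw x hx hwx
      obtain ⟨v, hv, rfl⟩ := mem_image.1 hwx
      by_contra hne
      have hvz : v ≠ z := fun h => hne (by rw [h])
      have h1 := hH.four_le v (H.edge_subset x hx hv) hvz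
      have h2 := hθ.degree_le v
      have h3 := card_filter_insert_le (insert a A) t (θ v)
      have h4 := card_filter_insert_le A a (θ v)
      have h5 := h.card_filter_le_one hH hw (hs _ hw)
      omega
    by_cases hz : θ z ∈ base H z ψ
    · refine ⟨ψ z, notMem_base hH h.inj, fun x hx hxA => ?_⟩
      obtain ⟨w, hw, y, hy, hxy⟩ := h.subset _ hxA
      refine ⟨y, hy, ?_⟩
      by_cases hzy : z ∈ y
      · have := hcenter w hw x hx (hxy ▸ mem_image_update hzy)
        exact absurd (this ▸ hz) hw
      · rw [hxy, image_update_of_notMem hzy, image_update_of_notMem hzy]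
    · refine ⟨θ z, hz, fun x hx hxA => ?_⟩
      obtain ⟨w, hw, y, hy, hxy⟩ := h.subset _ hxA
      refine ⟨y, hy, ?_⟩
      by_cases hzy : z ∈ y
      · rw [← hcenter w hw x hx (hxy ▸ mem_image_update hzy), hxy]
      · rw [hxy, image_update_of_notMem hzy, image_update_of_notMem hzy]
  · refine ⟨ψ z, notMem_base hH h.inj, fun x _ hxA => ?_⟩
    rw [Function.update_eq_self]
    exact hs _ hxA

theorem exists_pair_of_embedsVia (hH : IsPivot H z r g) {θ : V → ℕ} {a t : Finset ℕ}
    (hθ : EmbedsVia H θ (insert t (insert a A))) :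
    ∃ e ∈ H.edges, ∃ e' ∈ H.edges, e ≠ e' ∧
      ∀ x ∈ H.edges, x ≠ e → x ≠ e' → x.image θ ∈ A := by
  have h1 : (H.edges.filter fun x => x.image θ ∉ A).card ≤ 2 := by
    refine (card_le_card_of_injOn (t := {a, t}) (fun e => e.image θ) (fun e he => ?_)
      ((H.image_injOn hθ.1).mono fun e he => (mem_filter.1 he).1)).trans card_le_two
    have he' := mem_filter.1 he
    have := hθ.2 e he'.1
    simp only [mem_insert] at this
    simp only [coe_insert, coe_singleton, Set.mem_insert_iff, Set.mem_singleton_iff]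
    tauto
  have h2 : 2 ≤ H.edges.card := by
    have := hH.card_deleteVertex
    omega
  -- At most two edges land outside `A`; the set is padded to exactly two, because rigidity speaks
  -- of two distinct edges.
  obtain ⟨S, hS1, hS2, hS⟩ := exists_subsuperset_card_eq (filter_subset _ _) h1 h2
  obtain ⟨e, e', hne, rfl⟩ := card_eq_two.1 hS
  refine ⟨e, hS2 (by simp), e', hS2 (by simp), hne, fun x hx h3 h4 => ?_⟩
  by_contra hcon
  have := hS1 (mem_filter.2 ⟨hx, hcon⟩)
  simp [h3, h4] at this

theorem image_eq_image_update {θ : V → ℕ} (h : ∀ v ∈ H.verts, v ≠ z → θ v = ψ v)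
    {x : Finset V} (hx : x ⊆ H.verts) : x.image θ = x.image (Function.update ψ z (θ z)) := by
  refine image_congr fun v hv => ?_
  by_cases hvz : v = z
  · rw [hvz, Function.update_self]
  · rw [Function.update_of_ne hvz, h v (hx hv) hvz]

/-- Every copy of `H` in `A` and two more edges is some `update ψ z w`. -/
theorem Blocked.eq_update (hH : IsPivot H z r g) (h : Blocked H z r g ψ A B)
    {θ : V → ℕ} {a t : Finset ℕ} (hθ : EmbedsVia H θ (insert t (insert a A))) :
    θ z ∉ base H z ψ ∧
      ∀ x ∈ H.edges, x.image θ = x.image (Function.update ψ z (θ z)) := by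
  obtain ⟨w, hw, hcen⟩ := h.exists_center hH hθ
  obtain ⟨e, he, e', he', hne, hx⟩ := exists_pair_of_embedsVia hH hθ
  have heq : ∀ v ∈ H.verts, v ≠ z → θ v = ψ v := by
    intro v hv hvz
    rw [hH.eq_of_image_mem hθ.1 (h.injOn_update hw) he he' hne
      (fun x hxe h1 h2 => hcen x hxe (hx x hxe h1 h2)) hv hvz, Function.update_of_ne hvz]
  refine ⟨fun hmem => ?_, fun x hxe => image_eq_image_update heq (H.edge_subset x hxe)⟩
  obtain ⟨v, hv, hvz⟩ := mem_image.1 hmem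
  rw [mem_erase] at hv
  rw [← heq v hv.2 hv.1] at hvz
  exact hv.1 (hθ.1 hv.2 hH.mem hvz)

/-- After a further move `a` of the opponent, each of his threats `t` consists of `a` and `t` being
the two edges at the pivot of some `update ψ z w`. -/
theorem Blocked.threat (hH : IsPivot H z r g) (h : Blocked H z r g ψ A B)
    (hAB : Disjoint A B) {θ : V → ℕ} {a t : Finset ℕ} (haB : a ∉ B) (htB : t ∉ B)
    (hθ : EmbedsVia H θ (insert t (insert a A))) :
    a ≠ t ∧ ∃ w ∉ base H z ψ,
      (∀ w ∉ base H z ψ, r.image (Function.update ψ z w) ∈ A →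
        g.image (Function.update ψ z w) ∉ A) ∧
      ((a = r.image (Function.update ψ z w) ∧ t = g.image (Function.update ψ z w)) ∨
        (a = g.image (Function.update ψ z w) ∧ t = r.image (Function.update ψ z w))) := by
  obtain ⟨hw, heq⟩ := h.eq_update hH hθ
  have hin : ∀ x ∈ H.edges, x.image (Function.update ψ z (θ z)) ∈ insert t (insert a A) :=
    fun x hx => heq x hx ▸ hθ.2 x hx
  have hnot : ¬ ∃ x ∈ H.edges, x.image (Function.update ψ z (θ z)) ∈ B := by
    rintro ⟨x, hx, hxB⟩
    have := hin x hx
    rw [mem_insert, mem_insert] at this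
    rcases this with h1 | h1 | h1
    · exact htB (h1 ▸ hxB)
    · exact haB (h1 ▸ hxB)
    · exact (disjoint_left.1 hAB h1) hxB
  -- The threatened copy contains no edge of `B`. So the alternative in which every copy is hit
  -- fails, and neither pivot edge lies in `A`: they must be `a` and `t`.
  have hs := h.single.resolve_right fun hs => hnot (hs.2 _ hw)
  obtain ⟨hr, hg⟩ := (h.hit _ hw).resolve_left hnot
  have hne : r.image (Function.update ψ z (θ z)) ≠ g.image (Function.update ψ z (θ z)) :=
    fun h' => hH.ne (H.image_injOn (h.injOn_update hw) hH.r_mem hH.g_mem h')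
  have hr' := hin r hH.r_mem
  have hg' := hin g hH.g_mem
  rw [mem_insert, mem_insert] at hr' hg'
  have key : (a = r.image (Function.update ψ z (θ z)) ∧ t = g.image (Function.update ψ z (θ z))) ∨
      (a = g.image (Function.update ψ z (θ z)) ∧ t = r.image (Function.update ψ z (θ z))) := by
    rcases hr' with h1 | h1 | h1 <;> rcases hg' with h2 | h2 | h2
    · exact absurd (h1.trans h2.symm) hne
    · exact Or.inr ⟨h2.symm, h1.symm⟩
    · exact absurd h2 hg
    · exact Or.inl ⟨h1.symm, h2.symm⟩
    · exact absurd (h1.trans h2.symm) hne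
    · exact absurd h2 hg
    · exact absurd h1 hr
    · exact absurd h1 hr
    · exact absurd h1 hr
  refine ⟨?_, θ z, hw, hs, key⟩
  rcases key with ⟨rfl, rfl⟩ | ⟨rfl, rfl⟩
  · exact hne
  · exact hne.symm

/-- A finished copy would be a threat with `t = a`, but a threat needs two distinct new pivot edges.
-/
theorem Blocked.not_embedsVia (hH : IsPivot H z r g) (h : Blocked H z r g ψ A B)
    (hAB : Disjoint A B) {θ : V → ℕ} {a : Finset ℕ} (haB : a ∉ B) :
    ¬ EmbedsVia H θ (insert a A) := fun hθ =>
  (h.threat hH hAB haB haB (hθ.mono (subset_insert _ _))).1 rfl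

theorem Blocked.swap (h : Blocked H z r g ψ A B) : Blocked H z g r ψ A B where
  inj := h.inj
  subset := h.subset
  hit := fun w hw => (h.hit w hw).imp id And.symm
  single := h.single.imp (fun hs w hw h1 h2 => hs w hw h2 h1) id

/-- The copy centred at `w` is now hit by `B`. Copies with another centre keep their status, since a
pivot edge determines its centre as its only vertex off the base. -/
theorem Blocked.insert_of_eq (hH : IsPivot H z r g) (h : Blocked H z r g ψ A B)
    {w : ℕ} (hw : w ∉ base H z ψ) (hs : ∀ w ∉ base H z ψ, r.image (Function.update ψ z w) ∈ A →
        g.image (Function.update ψ z w) ∉ A) (ht : g.image (Function.update ψ z w) ∉ A) :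
    Blocked H z r g ψ (insert (r.image (Function.update ψ z w)) A)
      (insert (g.image (Function.update ψ z w)) B) := by
  have hne : r.image (Function.update ψ z w) ≠ g.image (Function.update ψ z w) :=
    fun h' => hH.ne (H.image_injOn (h.injOn_update hw) hH.r_mem hH.g_mem h')
  have hother : ∀ w' ∉ base H z ψ, w' ≠ w → ∀ x : Finset V, z ∈ x →
      x.image (Function.update ψ z w') ≠ r.image (Function.update ψ z w) := by
    intro w' hw' hww x hx heq
    exact hww (eq_of_mem_image_update hH.r_mem hw' (heq ▸ mem_image_update hx)).1.symm
  refine ⟨h.inj, ?_, ?_, Or.inl ?_⟩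
  · intro a ha
    rcases mem_insert.1 ha with rfl | ha
    · exact ⟨w, hw, r, hH.r_mem, rfl⟩
    · exact h.subset a ha
  · intro w' hw'
    by_cases hww : w' = w
    · subst hww
      exact Or.inl ⟨g, hH.g_mem, mem_insert_self _ _⟩
    · refine (h.hit w' hw').imp (fun ⟨x, hx, hxB⟩ => ⟨x, hx, mem_insert_of_mem hxB⟩) fun hn => ?_
      rw [mem_insert, mem_insert]
      exact ⟨not_or.2 ⟨hother w' hw' hww r hH.z_mem_r, hn.1⟩,
        not_or.2 ⟨hother w' hw' hww g hH.z_mem_g, hn.2⟩⟩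
  · intro w' hw' h1 h2
    by_cases hww : w' = w
    · subst hww
      exact (mem_insert.1 h2).elim (fun h => hne h.symm) ht
    · rw [mem_insert] at h1 h2
      exact hs w' hw' (h1.resolve_left (hother w' hw' hww r hH.z_mem_r))
        (h2.resolve_left (hother w' hw' hww g hH.z_mem_g))

/-- Blocking a threat restores the invariant. -/
theorem Blocked.block (hH : IsPivot H z r g) (h : Blocked H z r g ψ A B)
    (hAB : Disjoint A B) {θ : V → ℕ} {a t : Finset ℕ} (haB : a ∉ B) (htA : t ∉ A) (htB : t ∉ B)
    (hθ : EmbedsVia H θ (insert t (insert a A))) :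
    Blocked H z r g ψ (insert a A) (insert t B) := by
  obtain ⟨-, w, hw, hs, ⟨rfl, rfl⟩ | ⟨rfl, rfl⟩⟩ := h.threat hH hAB haB htB hθ
  · exact h.insert_of_eq hH hw hs htA
  · exact (h.swap.insert_of_eq hH.swap hw (fun w hw h1 h2 => hs w hw h2 h1) htA).swap

/-- The first block starts the invariant. If the blocked edge contains the pivot, the opponent lacks
a pivot edge at every centre. Otherwise that edge is common to all the copies `update ψ z w` and
hits them all at once; this accounts for the two alternatives in `single`. -/
theorem Blocked.of_eq (hH : IsPivot H z r g) (hψ : Set.InjOn ψ H.verts)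
    (hA : ∀ a ∈ A, ∃ x ∈ H.edges, a = x.image ψ) {e : Finset V} (he : e ∈ H.edges)
    (heA : e.image ψ ∉ A) : Blocked H z r g ψ A (insert (e.image ψ) B) := by
  have hz := notMem_base hH hψ
  have hself : Function.update ψ z (ψ z) = ψ := Function.update_eq_self z ψ
  have hfar : ∀ w ∉ base H z ψ, w ≠ ψ z → ∀ x : Finset V, z ∈ x → x.image (Function.update ψ z w) ∉ A := by
    intro w hw hwz x hx hxA
    obtain ⟨y, hy, hxy⟩ := hA _ hxA
    have h1 : w ∈ y.image (Function.update ψ z (ψ z)) := by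
      rw [hself, ← hxy]; exact mem_image_update hx
    exact hwz (eq_of_mem_image_update hy hw h1).1.symm
  refine ⟨hψ, fun a ha => ⟨ψ z, hz, by rw [hself]; exact hA a ha⟩, fun w hw => ?_, ?_⟩
  · by_cases hwz : w = ψ z
    · subst hwz
      exact Or.inl ⟨e, he, by rw [hself]; exact mem_insert_self _ _⟩
    · exact Or.inr ⟨hfar w hw hwz r hH.z_mem_r, hfar w hw hwz g hH.z_mem_g⟩
  · by_cases hze : z ∈ e
    · left
      intro w hw h1 h2
      by_cases hwz : w = ψ z
      · subst hwz
        rw [hself] at h1 h2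
        rcases hH.eq_or e he hze with rfl | rfl
        · exact heA h1
        · exact heA h2
      · exact hfar w hw hwz r hH.z_mem_r h1
    · exact Or.inr ⟨hA, fun w _ => ⟨e, he, by
        rw [image_update_of_notMem hze]; exact mem_insert_self _ _⟩⟩

end IsPivot

end Pivot

end RamseyGame

/-! ### The pressing phase and the passage to it. -/

namespace RamseyGame

open Finset

namespace IsPivot

variable {k : ℕ} {V : Type*} [DecidableEq V] {H : KGraph k V} {z : V} {r g : Finset V}
  {A B : Finset (Finset ℕ)} {f : V → ℕ}

/-- The player holding `B` owns a copy of `H ∖ {z}` through `f`, his opponent has no threat, and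
answering the edge `r` at a new pivot by the edge `g` never gives the opponent one. -/
structure Pressing (H : KGraph k V) (z : V) (r g : Finset V) (f : V → ℕ)
    (A B : Finset (Finset ℕ)) : Prop where
  copy : EmbedsVia (H.deleteVertex z) f B
  noThreat : ∀ θ t, t ∉ A → t ∉ B → ¬ EmbedsVia H θ (insert t A)
  choice : ∀ χ, EmbedsVia (H.deleteVertex z) χ A →
    ((g.erase z).image f = (r.erase z).image χ → (r.erase z).image f = (g.erase z).image χ) ∧
    ((g.erase z).image f = (g.erase z).image χ → (r.erase z).image f = (r.erase z).image χ)

theorem Pressing.not_embedsVia (h : Pressing H z r g f A B) (θ : V → ℕ) : ¬ EmbedsVia H θ A := by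
  obtain ⟨t, ht⟩ := Infinite.exists_notMem_finset (A ∪ B)
  rw [mem_union, not_or] at ht
  exact fun hθ => h.noThreat θ t ht.1 ht.2 (hθ.mono (subset_insert _ _))

/-- The player holding `B` can complete a copy of `H` at once, and his opponent has none yet. -/
def CanFinish (H : KGraph k V) (A B : Finset (Finset ℕ)) : Prop :=
  (¬ ∃ θ, EmbedsVia H θ A) ∧
    ∃ c : Finset ℕ, c.card = k ∧ c ∉ A ∧ c ∉ B ∧ ∃ θ, EmbedsVia H θ (insert c B)

theorem card_filter_eq_zero {w : ℕ} (h : ∀ a ∈ A, w ∉ a) :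
    (A.filter fun a => w ∈ a).card = 0 := by
  rw [card_eq_zero, filter_eq_empty_iff]
  exact fun a ha => h a ha

theorem image_eq_insert {θ : V → ℕ} {x : Finset V} (hx : z ∈ x) :
    x.image θ = insert (θ z) ((x.erase z).image θ) := by
  rw [← image_update_of_mem hx, Function.update_eq_self]

theorem image_erase_eq_of_image_eq (hH : IsPivot H z r g) {θ : V → ℕ}
    (hθ : Set.InjOn θ H.verts) {w : ℕ} (hw : w ∉ base H z f) {x y : Finset V}
    (hx : x ∈ H.edges) (hy : y ∈ H.edges) (hzx : z ∈ x) (hzy : z ∈ y) (hθz : θ z = w)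
    (h : x.image θ = y.image (Function.update f z w)) :
    (y.erase z).image f = (x.erase z).image θ := by
  rw [image_eq_insert hzx, image_update_of_mem hzy, hθz] at h
  have h1 : w ∉ (x.erase z).image θ := by
    intro hmem
    exact notMem_base hH hθ (hθz ▸ image_subset_image (erase_subset_erase _
      (H.edge_subset x hx)) hmem)
  have h2 : w ∉ (y.erase z).image f := fun hmem =>
    hw (image_subset_image (erase_subset_erase _ (H.edge_subset y hy)) hmem)
  rw [← erase_insert h1, ← erase_insert h2, h]

/-- A new threat must use the forced edge at the fresh vertex `w`, with `w` as pivot. Its other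
pivot edge is then `t`, the rest is a copy of `H ∖ {z}` in `A`, and `choice` identifies `t` with the
edge just claimed by the presser. -/
theorem Pressing.noThreat_step (hH : IsPivot H z r g) (h : Pressing H z r g f A B) {w : ℕ}
    (hwA : ∀ a ∈ A, w ∉ a) (hwf : w ∉ base H z f) {θ : V → ℕ} {t : Finset ℕ}
    (htA : t ∉ A) (htB : t ∉ B) (htr : t ≠ r.image (Function.update f z w)) :
    ¬ EmbedsVia H θ (insert t (insert (g.image (Function.update f z w)) A)) := by
  set c := g.image (Function.update f z w) with hc
  intro hθ
  have hwc : w ∈ c := mem_image_update hH.z_mem_g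
  obtain ⟨x, hx, hxc⟩ : ∃ x ∈ H.edges, x.image θ = c := by
    by_contra hcon
    push Not at hcon
    refine h.noThreat θ t htA htB ⟨hθ.1, fun x hx => ?_⟩
    have := hθ.2 x hx
    rw [mem_insert, mem_insert] at this
    rw [mem_insert]
    have := hcon x hx
    tauto
  -- Only `c` and `t` can contain the fresh vertex, so its degree is at most 2.
  have hθz : θ z = w := by
    obtain ⟨v, hv, hvw⟩ := mem_image.1 (hxc ▸ hwc)
    by_contra hne
    have hvz : v ≠ z := fun h => hne (h ▸ hvw)
    have h1 := hH.four_le v (H.edge_subset x hx hv) hvz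
    have h2 := hθ.degree_le v
    have h3 := card_filter_insert_le (insert c A) t (θ v)
    have h4 := card_filter_insert_le A c (θ v)
    have h5 : (A.filter fun a => θ v ∈ a).card = 0 := card_filter_eq_zero (by rwa [hvw])
    omega
  have hpend : ∀ y ∈ H.edges, z ∈ y → y.image θ = t ∨ y.image θ = c := by
    intro y hy hzy
    have h1 := hθ.2 y hy
    have h2 : y.image θ ∉ A := fun h' => hwA _ h' (hθz ▸ mem_image_of_mem _ hzy)
    rw [mem_insert, mem_insert] at h1
    tauto
  have hne : r.image θ ≠ g.image θ := fun h' =>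
    hH.ne (H.image_injOn hθ.1 hH.r_mem hH.g_mem h')
  have hχ : w ∈ t → EmbedsVia (H.deleteVertex z) θ A := by
    intro hwt
    refine ⟨hθ.1.mono (coe_subset.2 (erase_subset _ _)), fun y hy => ?_⟩
    rw [mem_deleteVertex] at hy
    have h1 := hθ.2 y hy.1
    have h2 : w ∉ y.image θ := by
      rw [← hθz, mem_image_iff_of_injOn hθ.1 (H.edge_subset y hy.1) hH.mem]
      exact hy.2
    rw [mem_insert, mem_insert] at h1
    rcases h1 with h1 | h1 | h1
    · exact absurd (h1 ▸ hwt) h2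
    · exact absurd (h1 ▸ hwc) h2
    · exact h1
  have hfin : ∀ y ∈ H.edges, z ∈ y → (r.erase z).image f = (y.erase z).image θ →
      y.image θ = r.image (Function.update f z w) := by
    intro y _ hzy heq
    rw [image_eq_insert hzy, image_update_of_mem hH.z_mem_r, hθz, heq]
  rcases hpend r hH.r_mem hH.z_mem_r with hr | hr <;>
    rcases hpend g hH.g_mem hH.z_mem_g with hg | hg
  · exact hne (hr.trans hg.symm)
  · have hwt : w ∈ t := hr ▸ hθz ▸ mem_image_of_mem _ hH.z_mem_r
    exact htr (hr ▸ hfin r hH.r_mem hH.z_mem_r ((h.choice θ (hχ hwt)).2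
      (image_erase_eq_of_image_eq hH hθ.1 hwf hH.g_mem hH.g_mem hH.z_mem_g hH.z_mem_g hθz hg)))
  · have hwt : w ∈ t := hg ▸ hθz ▸ mem_image_of_mem _ hH.z_mem_g
    exact htr (hg ▸ hfin g hH.g_mem hH.z_mem_g ((h.choice θ (hχ hwt)).1
      (image_erase_eq_of_image_eq hH hθ.1 hwf hH.r_mem hH.g_mem hH.z_mem_r hH.z_mem_g hθz hr)))
  · exact hne (hr.trans hg.symm)

/-- An edge with a fresh vertex is useless for a graph of minimum degree 3. Hence `choice` survives
the opponent's forced replies. -/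
theorem embedsVia_of_insert (hH : IsPivot H z r g) {w : ℕ} (hwA : ∀ a ∈ A, w ∉ a)
    {c : Finset ℕ} (hwc : w ∈ c) {χ : V → ℕ}
    (hχ : EmbedsVia (H.deleteVertex z) χ (insert c A)) : EmbedsVia (H.deleteVertex z) χ A := by
  refine ⟨hχ.1, fun x hx => (mem_insert.1 (hχ.2 x hx)).resolve_left fun hxc => ?_⟩
  obtain ⟨v, hv, hvw⟩ := mem_image.1 (hxc ▸ hwc)
  have hvm := mem_erase.1 ((H.deleteVertex z).edge_subset x hx hv)
  have h1 := hH.three_le v hvm.2 hvm.1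
  have h2 := hχ.degree_le v
  have h3 := card_filter_insert_le A c (χ v)
  have h5 : (A.filter fun a => χ v ∈ a).card = 0 := card_filter_eq_zero (by rwa [hvw])
  omega

/-- Claiming `r` at a fresh pivot threatens to finish with `g` there. Any other reply loses the
race, as the opponent had no threat; the forced reply restores the invariant. -/
theorem Pressing.step (hH : IsPivot H z r g) (h : Pressing H z r g f A B) :
    ∃ c : Finset ℕ, c.card = k ∧ c ∉ A ∧ c ∉ B ∧ ∀ b : Finset ℕ, b ∉ A → b ∉ B → b ≠ c →
      CanFinish H (insert b A) (insert c B) ∨ Pressing H z r g f (insert b A) (insert c B) := by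
  obtain ⟨w, hwf, hw⟩ := exists_notMem_of_finite (A ∪ B) (base H z f)
  have hwA : ∀ a ∈ A, w ∉ a := fun a ha => hw a (mem_union_left _ ha)
  have hwB : ∀ a ∈ B, w ∉ a := fun a ha => hw a (mem_union_right _ ha)
  have hinj : Set.InjOn (Function.update f z w) H.verts := injOn_update h.copy.1 hwf
  have hcard : ∀ x ∈ H.edges, (x.image (Function.update f z w)).card = k := fun x hx => by
    rw [card_image_of_injOn (hinj.mono (coe_subset.2 (H.edge_subset x hx))), H.uniform x hx]
  have hwr : w ∈ r.image (Function.update f z w) := mem_image_update hH.z_mem_r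
  have hwg : w ∈ g.image (Function.update f z w) := mem_image_update hH.z_mem_g
  have hne : r.image (Function.update f z w) ≠ g.image (Function.update f z w) := fun h' =>
    hH.ne (H.image_injOn hinj hH.r_mem hH.g_mem h')
  refine ⟨r.image (Function.update f z w), hcard r hH.r_mem, fun h' => hwA _ h' hwr,
    fun h' => hwB _ h' hwr, fun b hbA hbB hbc => ?_⟩
  by_cases hb : b = g.image (Function.update f z w)
  · right
    subst hb
    refine ⟨h.copy.mono (subset_insert _ _), fun θ t ht1 ht2 => ?_, fun χ hχ =>
      h.choice χ (embedsVia_of_insert hH hwA hwg hχ)⟩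
    rw [mem_insert, not_or] at ht1 ht2
    exact h.noThreat_step hH hwA hwf ht1.2 ht2.2 ht2.1
  · left
    refine ⟨fun ⟨θ, hθ⟩ => h.noThreat θ b hbA hbB hθ, g.image (Function.update f z w),
      hcard g hH.g_mem, ?_, ?_, Function.update f z w, hinj, fun x hx => ?_⟩
    · rw [mem_insert, not_or]
      exact ⟨fun h' => hb h'.symm, fun h' => hwA _ h' hwg⟩
    · rw [mem_insert, not_or]
      exact ⟨hne.symm, fun h' => hwB _ h' hwg⟩
    · by_cases hzx : z ∈ x
      · rcases hH.eq_or x hx hzx with rfl | rfl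
        · exact mem_insert_of_mem (mem_insert_self _ _)
        · exact mem_insert_self _ _
      · rw [image_update_of_notMem hzx]
        exact mem_insert_of_mem (mem_insert_of_mem (h.copy.2 x (mem_deleteVertex.2 ⟨hx, hzx⟩)))

/-- If both pivot edges of `f` are covered by the image of `ψ`, there is no room left for a
further edge in that image. -/
theorem not_disjoint_of_subset (hH : IsPivot H z r g) {ψ : V → ℕ} (hψ : Set.InjOn ψ H.verts)
    (hf : Set.InjOn f (H.verts.erase z : Finset V)) {e : Finset ℕ} (he : e.card = k)
    (heψ : e ⊆ H.verts.image ψ) (hfe : ∀ v ∈ H.verts, v ≠ z → f v ∉ e)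
    (hr : (r.erase z).image f ⊆ H.verts.image ψ) (hg : (g.erase z).image f ⊆ H.verts.image ψ) :
    False := by
  have hrg : r ∪ g ⊆ H.verts :=
    union_subset (H.edge_subset r hH.r_mem) (H.edge_subset g hH.g_mem)
  have hsub : ((r ∪ g).erase z).image f ⊆ H.verts.image ψ \ e := by
    intro x hx
    obtain ⟨v, hv, rfl⟩ := mem_image.1 hx
    rw [mem_erase, mem_union] at hv
    refine mem_sdiff.2 ⟨?_, hfe v (hrg (mem_union.2 hv.2)) hv.1⟩
    rcases hv.2 with h | h
    · exact hr (mem_image_of_mem _ (mem_erase.2 ⟨hv.1, h⟩))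
    · exact hg (mem_image_of_mem _ (mem_erase.2 ⟨hv.1, h⟩))
  -- The count gives |r ∪ g| - 1 ≤ |V(H)| - k, which contradicts `small`.
  have h1 := card_le_card hsub
  rw [card_image_of_injOn (hf.mono (coe_subset.2 (erase_subset_erase _ hrg))),
    card_sdiff_of_subset heψ, card_image_of_injOn hψ,
    card_erase_of_mem (mem_union_left _ hH.z_mem_r), he] at h1
  have h2 := hH.small
  rw [card_sdiff_of_subset hrg] at h2
  have h3 := card_le_card heψ
  rw [card_image_of_injOn hψ, he] at h3
  have h4 := card_le_card hrg
  have h5 : 0 < (r ∪ g).card := card_pos.2 ⟨z, mem_union_left _ hH.z_mem_r⟩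
  omega

/-- Outside the image of `ψ` a vertex has degree at most 1 in `A`, so at most 2 after the move `a`,
too little for `H ∖ {z}`. -/
theorem Blocked.mem_image_of_embedsVia (hH : IsPivot H z r g) {ψ : V → ℕ}
    (h : Blocked H z r g ψ A B) {a : Finset ℕ} {χ : V → ℕ}
    (hχ : EmbedsVia (H.deleteVertex z) χ (insert a A)) {v : V} (hv : v ∈ H.verts)
    (hvz : v ≠ z) : χ v ∈ H.verts.image ψ := by
  by_contra hcon
  have hw : χ v ∉ base H z ψ := fun h' => hcon (image_subset_image (erase_subset _ _) h')
  have hs : r.image (Function.update ψ z (χ v)) ∈ A →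
      g.image (Function.update ψ z (χ v)) ∉ A := by
    rcases h.single with hs | ⟨hs, -⟩
    · exact hs _ hw
    · intro hr
      obtain ⟨x, hx, hxr⟩ := hs _ hr
      have h1 : χ v ∈ x.image ψ := hxr ▸ mem_image_update hH.z_mem_r
      exact absurd (image_subset_image (H.edge_subset x hx) h1) hcon
  have h1 := hH.three_le v hv hvz
  have h2 := hχ.degree_le v
  have h3 := card_filter_insert_le A a (χ v)
  have h4 := h.card_filter_le_one hH hw hs
  omega

/-- Every opposing copy of `H ∖ {z}` stays inside the image of `ψ`. If the trace of `g` or of `r`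
under `f` leaves that image, `choice` holds vacuously for the corresponding order; both traces
cannot stay inside, as `f` avoids `e`. -/
theorem Blocked.pressing (hH : IsPivot H z r g) {ψ : V → ℕ} (h : Blocked H z r g ψ A B)
    {a e : Finset ℕ} (he : e.card = k) (heψ : e ⊆ H.verts.image ψ)
    (hf : EmbedsVia (H.deleteVertex z) f B) (hfe : ∀ v ∈ H.verts, v ≠ z → f v ∉ e)
    (hno : ∀ θ t, t ∉ insert a A → t ∉ B → ¬ EmbedsVia H θ (insert t (insert a A))) :
    Pressing H z r g f (insert a A) B ∨ Pressing H z g r f (insert a A) B := by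
  have hsub : ∀ χ, EmbedsVia (H.deleteVertex z) χ (insert a A) → ∀ x ∈ H.edges,
      (x.erase z).image χ ⊆ H.verts.image ψ := by
    intro χ hχ x hx y hy
    obtain ⟨v, hv, rfl⟩ := mem_image.1 hy
    rw [mem_erase] at hv
    exact h.mem_image_of_embedsVia hH hχ (H.edge_subset x hx hv.2) hv.1
  by_contra hcon
  rw [not_or] at hcon
  have hg : (g.erase z).image f ⊆ H.verts.image ψ := by
    by_contra hg
    refine hcon.1 ⟨hf, hno, fun χ hχ => ⟨fun h' => ?_, fun h' => ?_⟩⟩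
    · exact absurd (h' ▸ hsub χ hχ r hH.r_mem) hg
    · exact absurd (h' ▸ hsub χ hχ g hH.g_mem) hg
  have hr : (r.erase z).image f ⊆ H.verts.image ψ := by
    by_contra hr
    refine hcon.2 ⟨hf, hno, fun χ hχ => ⟨fun h' => ?_, fun h' => ?_⟩⟩
    · exact absurd (h' ▸ hsub χ hχ g hH.g_mem) hr
    · exact absurd (h' ▸ hsub χ hχ r hH.r_mem) hr
  exact not_disjoint_of_subset hH h.inj hf.1 he heψ hfe hr hg

/-- Two copies of `H ∖ {z}` with the same edges agree. -/
theorem eq_of_embedsVia_deleteVertex (hH : IsPivot H z r g) {χ χ' : V → ℕ}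
    {S : Finset (Finset ℕ)} (hS : S.card ≤ (H.deleteVertex z).edges.card)
    (hχ : EmbedsVia (H.deleteVertex z) χ S) (hχ' : EmbedsVia (H.deleteVertex z) χ' S)
    {v : V} (hv : v ∈ H.verts) (hvz : v ≠ z) : χ v = χ' v := by
  obtain ⟨w, hw⟩ := Infinite.exists_notMem_finset (base H z χ)
  obtain ⟨w', hw'⟩ := Infinite.exists_notMem_finset (base H z χ')
  have := hH.eq_of_image_mem (injOn_update hχ.1 hw) (injOn_update hχ'.1 hw') hH.r_mem hH.g_mem
    hH.ne (fun x hx h1 h2 => ?_) hv hvz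
  · rwa [Function.update_of_ne hvz, Function.update_of_ne hvz] at this
  · have hzx : z ∉ x := fun hzx => (hH.eq_or x hx hzx).elim h1 h2
    obtain ⟨y, hy, hyx⟩ :=
      hχ'.exists_eq_of_card_le hS (hχ.2 x (mem_deleteVertex.2 ⟨hx, hzx⟩))
    rw [mem_deleteVertex] at hy
    refine ⟨y, hy.1, ?_⟩
    rw [image_update_of_notMem hzx, image_update_of_notMem hy.2, hyx]

/-- A copy χ that shares a pivot trace with `f` cannot use `e`, because each of its edges meets that
trace while `f` avoids `e`. So χ fills `A.erase e` and is unique. If both orders failed, both traces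
of `f` would be traces of this one χ; being distinct, they would match it completely, so the first
order would not have failed. -/
theorem pressing_of_card (hH : IsPivot H z r g) {e : Finset ℕ} (heA : e ∈ A)
    (hA : A.card + 1 = H.edges.card)
    (hf : EmbedsVia (H.deleteVertex z) f B) (hfe : ∀ v ∈ H.verts, v ≠ z → f v ∉ e)
    (hno : ∀ θ t, t ∉ A → t ∉ B → ¬ EmbedsVia H θ (insert t A)) :
    Pressing H z r g f A B ∨ Pressing H z g r f A B := by
  have hcard : (A.erase e).card ≤ (H.deleteVertex z).edges.card := by
    have := hH.card_deleteVertex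
    rw [card_erase_of_mem heA]
    omega
  have havoid : ∀ χ, EmbedsVia (H.deleteVertex z) χ A → ∀ x ∈ H.edges, ∀ y ∈ H.edges,
      (∀ u ∈ H.edges, (u ∩ x).Nonempty) → (y.erase z).image f = (x.erase z).image χ →
      EmbedsVia (H.deleteVertex z) χ (A.erase e) := by
    intro χ hχ x hx y hy hmeet hxy
    refine ⟨hχ.1, fun u hu => mem_erase.2 ⟨fun hue => ?_, hχ.2 u hu⟩⟩
    rw [mem_deleteVertex] at hu
    obtain ⟨v, hv⟩ := hmeet u hu.1
    rw [mem_inter] at hv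
    have hvz : v ≠ z := fun h => hu.2 (h ▸ hv.1)
    have h1 : χ v ∈ e := hue ▸ mem_image_of_mem _ hv.1
    have h2 : χ v ∈ (y.erase z).image f := hxy ▸ mem_image_of_mem _ (mem_erase.2 ⟨hvz, hv.2⟩)
    obtain ⟨u', hu', hu''⟩ := mem_image.1 h2
    rw [mem_erase] at hu'
    exact hfe u' (H.edge_subset y hy hu'.2) hu'.1 (hu'' ▸ h1)
  have hmr : ∀ u ∈ H.edges, (u ∩ r).Nonempty := fun u hu => (hH.meet u hu).1
  have hmg : ∀ u ∈ H.edges, (u ∩ g).Nonempty := fun u hu => (hH.meet u hu).2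
  have hsame : ∀ χ χ', EmbedsVia (H.deleteVertex z) χ (A.erase e) →
      EmbedsVia (H.deleteVertex z) χ' (A.erase e) → ∀ x ∈ H.edges,
      (x.erase z).image χ = (x.erase z).image χ' := fun χ χ' hχ hχ' x hx =>
    image_congr fun v hv => eq_of_embedsVia_deleteVertex hH hcard hχ hχ'
      (H.edge_subset x hx (mem_of_mem_erase hv)) (ne_of_mem_erase hv)
  have hne : (r.erase z).image f ≠ (g.erase z).image f := by
    intro h
    have := eq_of_image_eq_of_injOn hf.1 (erase_subset_erase z (H.edge_subset r hH.r_mem))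
      (erase_subset_erase z (H.edge_subset g hH.g_mem)) h
    exact hH.ne (by rw [← insert_erase hH.z_mem_r, this, insert_erase hH.z_mem_g])
  by_contra hcon
  rw [not_or] at hcon
  obtain ⟨χ, hχ, hχ1⟩ : ∃ χ, EmbedsVia (H.deleteVertex z) χ (A.erase e) ∧
      (((g.erase z).image f = (r.erase z).image χ ∧ (r.erase z).image f ≠ (g.erase z).image χ) ∨
      ((g.erase z).image f = (g.erase z).image χ ∧
        (r.erase z).image f ≠ (r.erase z).image χ)) := by
    by_contra hc
    push Not at hc
    refine hcon.1 ⟨hf, hno, fun χ hχ => ⟨fun h => ?_, fun h => ?_⟩⟩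
    · exact (hc χ (havoid χ hχ r hH.r_mem g hH.g_mem hmr h)).1 h
    · exact (hc χ (havoid χ hχ g hH.g_mem g hH.g_mem hmg h)).2 h
  -- Of the failure of the second order only the premise is needed: the trace of `r` is also one of
  -- the traces of the opponent's copy.
  obtain ⟨χ', hχ', hχ2⟩ : ∃ χ, EmbedsVia (H.deleteVertex z) χ (A.erase e) ∧
      ((r.erase z).image f = (g.erase z).image χ ∨
        (r.erase z).image f = (r.erase z).image χ) := by
    by_contra hc
    push Not at hc
    refine hcon.2 ⟨hf, hno, fun χ hχ => ⟨fun h => ?_, fun h => ?_⟩⟩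
    · exact absurd h (hc χ (havoid χ hχ g hH.g_mem r hH.r_mem hmg h)).1
    · exact absurd h (hc χ (havoid χ hχ r hH.r_mem r hH.r_mem hmr h)).2
  rw [hsame χ' χ hχ' hχ r hH.r_mem, hsame χ' χ hχ' hχ g hH.g_mem] at hχ2
  rcases hχ1 with ⟨h1, h2⟩ | ⟨h1, h2⟩ <;> rcases hχ2 with h3 | h3
  · exact h2 h3
  · exact hne (h3.trans h1.symm)
  · exact hne (h3.trans h1.symm)
  · exact h2 h3

end IsPivot

theorem EmbedsVia.exists_image_eq_of_insert {k : ℕ} {V : Type*} {H : KGraph k V}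
    {A : Finset (Finset ℕ)} {θ : V → ℕ} {t : Finset ℕ} (hθ : EmbedsVia H θ (insert t A))
    (hA : ¬ EmbedsVia H θ A) : ∃ e ∈ H.edges, e.image θ = t ∧ t.card = k := by
  by_contra hcon
  push Not at hcon
  refine hA ⟨hθ.1, fun e he => (mem_insert.1 (hθ.2 e he)).resolve_left fun het => ?_⟩
  refine hcon e he het ?_
  rw [← het, card_image_of_injOn (hθ.1.mono (coe_subset.2 (H.edge_subset e he))),
    H.uniform e he]

theorem Forces.mono {k : ℕ} {T T' : Finset (Finset ℕ) → Prop} (hT : ∀ B, T B → T' B) {n : ℕ}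
    {A B : Finset (Finset ℕ)} (h : Forces k T n A B) : Forces k T' n A B := by
  induction n generalizing A B with
  | zero => exact hT B h
  | succ n ih =>
    obtain ⟨c, hc, h1, h2, h3⟩ := h
    exact ⟨c, hc, h1, h2, fun b hb hA hB hbc => ih (h3 b hb hA hB hbc)⟩

/-- A fast winning strategy can be carried out disjointly from an edge of the opponent. -/
theorem HasFastWinningStrategy.forces_avoiding {k : ℕ} {V : Type*} {F : KGraph k V} (hk : k ≠ 0)
    (h : HasFastWinningStrategy F) {a : Finset ℕ} (ha : a.card = k) :
    Forces k (fun B => ∃ f, EmbedsVia F f B ∧ ∀ v, f v ∉ a) F.edges.card {a} ∅ := by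
  set N := a.sup id + 1
  have hι : Function.Injective fun n : ℕ => n + N := fun _ _ h => Nat.add_right_cancel h
  have hout : ∀ n, n + N ∉ a := fun n hn => by
    have : n + N ≤ a.sup id := le_sup (f := id) hn
    omega
  -- The board is shifted beyond all vertices of `a`, so `a` has no preimage and the simulated game
  -- starts from the empty position.
  have h1 := h.forces.image hk hι (A' := {a}) fun x hx => by
    rw [mem_singleton] at hx
    rcases x.eq_empty_or_nonempty with rfl | ⟨y, hy⟩
    · rw [image_empty] at hx
      rw [← hx, card_empty] at ha
      exact absurd ha.symm hk
    · exact absurd (hx ▸ mem_image_of_mem _ hy) (hout y)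
  rw [image_empty] at h1
  refine h1.mono ?_
  rintro _ ⟨B, ⟨f, hf⟩, rfl⟩
  refine ⟨fun v => f v + N, ⟨hι.comp_injOn hf.1, fun e he => mem_image.2 ⟨_, hf.2 e he, ?_⟩⟩,
    fun v => hout _⟩
  rw [image_image]
  rfl

/-! ### Assembling the drawing strategy. -/

namespace IsPivot

variable {k : ℕ} {V : Type*} [DecidableEq V] {H : KGraph k V} {z : V} {r g : Finset V}
  {A B : Finset (Finset ℕ)}

/-- The positions, with the player holding `B` on turn, through which the drawing strategy leads. -/
inductive Good (H : KGraph k V) (z : V) (r g : Finset V) (A B : Finset (Finset ℕ)) : Prop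
  | won (f : V → ℕ) (h : EmbedsVia H f B)
  | finish (h : CanFinish H A B)
  | pressing (f : V → ℕ) (h : Pressing H z r g f A B ∨ Pressing H z g r f A B)
  | blocked (A' : Finset (Finset ℕ)) (a e : Finset ℕ) (f ψ : V → ℕ) (hA : A = insert a A')
      (h : Blocked H z r g ψ A' B) (he : e.card = k) (heψ : e ⊆ H.verts.image ψ)
      (hf : EmbedsVia (H.deleteVertex z) f B) (hfe : ∀ v, f v ∉ e)
  | building (n : ℕ) (e : Finset ℕ) (he : e.card = k) (heA : e ∈ A)
      (h : Forces k (fun B => ∃ f, EmbedsVia (H.deleteVertex z) f B ∧ ∀ v, f v ∉ e) n A B)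
      (hn : A.card + n + 1 = H.edges.card)

theorem Good.safe (hH : IsPivot H z r g) (hAB : Disjoint A B) (h : Good H z r g A B)
    (hA : ∃ θ, EmbedsVia H θ A) : ∃ θ, EmbedsVia H θ B := by
  obtain ⟨θ, hθ⟩ := hA
  rcases h with ⟨f, h⟩ | h | ⟨f, h | h⟩ | ⟨A', a, e, f, ψ, rfl, h, -, -, -, -⟩ |
    ⟨n, e, -, -, -, hn⟩
  · exact ⟨f, h⟩
  · exact absurd ⟨θ, hθ⟩ h.1
  · exact absurd hθ (h.not_embedsVia θ)
  · exact absurd hθ (h.not_embedsVia θ)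
  · rw [disjoint_insert_left] at hAB
    exact absurd hθ (h.not_embedsVia hH hAB.2 hAB.1)
  · have := hθ.card_le
    omega

theorem Pressing.good_step (hH : IsPivot H z r g) {f : V → ℕ}
    (h : Pressing H z r g f A B ∨ Pressing H z g r f A B) :
    ∃ c : Finset ℕ, c.card = k ∧ c ∉ A ∧ c ∉ B ∧ ∀ b : Finset ℕ, b.card = k → b ∉ A → b ∉ B →
      b ≠ c → Good H z r g (insert b A) (insert c B) := by
  rcases h with h | h
  · obtain ⟨c, hc, h1, h2, h3⟩ := h.step hH
    exact ⟨c, hc, h1, h2, fun b _ hA hB hbc =>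
      (h3 b hA hB hbc).elim .finish fun h => .pressing f (.inl h)⟩
  · obtain ⟨c, hc, h1, h2, h3⟩ := h.step hH.swap
    exact ⟨c, hc, h1, h2, fun b _ hA hB hbc =>
      (h3 b hA hB hbc).elim .finish fun h => .pressing f (.inr h)⟩

/-- A threat is always blocked, and in its absence pressing begins. In the case `blocked` the set
`A'` omits the opponent's last move `a`, since `Blocked` describes the position just after the
previous block. -/
theorem Good.step (hH : IsPivot H z r g) (hk : k ≠ 0) (hAB : Disjoint A B)
    (h : Good H z r g A B) :
    ∃ c : Finset ℕ, c.card = k ∧ c ∉ A ∧ c ∉ B ∧ ∀ b : Finset ℕ, b.card = k → b ∉ A → b ∉ B →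
      b ≠ c → Good H z r g (insert b A) (insert c B) := by
  rcases h with ⟨f, h⟩ | ⟨-, c, hc, h1, h2, θ, hθ⟩ | ⟨f, h⟩ |
    ⟨A', a, e, f, ψ, rfl, h, he, heψ, hf, hfe⟩ | ⟨n, e, he, heA, h, hn⟩
  · obtain ⟨c, hc, hnew⟩ := exists_card_eq_notMem hk (A ∪ B)
    rw [mem_union, not_or] at hnew
    exact ⟨c, hc, hnew.1, hnew.2, fun b _ _ _ _ => .won f (h.mono (subset_insert _ _))⟩
  · exact ⟨c, hc, h1, h2, fun b _ _ _ _ => .won θ hθ⟩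
  · exact Pressing.good_step hH h
  · by_cases hno : ∀ θ t, t ∉ insert a A' → t ∉ B → ¬ EmbedsVia H θ (insert t (insert a A'))
    · exact Pressing.good_step hH (h.pressing hH he heψ hf (fun v _ _ => hfe v) hno)
    · push Not at hno
      obtain ⟨θ, t, htA, htB, hθ⟩ := hno
      rw [disjoint_insert_left] at hAB
      obtain ⟨-, -, -, htk⟩ := hθ.exists_image_eq_of_insert (h.not_embedsVia hH hAB.2 hAB.1)
      refine ⟨t, htk, htA, htB, fun b _ _ _ _ => ?_⟩
      rw [mem_insert, not_or] at htA
      exact .blocked _ b e f ψ rfl (h.block hH hAB.2 hAB.1 htA.2 htB hθ) he heψ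
        (hf.mono (subset_insert _ _)) hfe
  · rcases n with _ | n
    · obtain ⟨f, hf, hfe⟩ := h
      by_cases hno : ∀ θ t, t ∉ A → t ∉ B → ¬ EmbedsVia H θ (insert t A)
      · exact Pressing.good_step hH
          (pressing_of_card hH heA (by omega) hf (fun v _ _ => hfe v) hno)
      · push Not at hno
        obtain ⟨θ, t, htA, htB, hθ⟩ := hno
        obtain ⟨x, hx, rfl, htk⟩ := hθ.exists_image_eq_of_insert fun h => by
          have := h.card_le
          omega
        refine ⟨x.image θ, htk, htA, htB, fun b _ _ _ _ => ?_⟩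
        -- With `t` the opponent has exactly as many edges as `H`, so all of them, `e` included,
        -- belong to the threatened copy.
        have hall : ∀ a ∈ A, ∃ y ∈ H.edges, a = y.image θ := by
          intro a ha
          obtain ⟨y, hy, hya⟩ := hθ.exists_eq_of_card_le
            (by rw [card_insert_of_notMem htA]; omega) (mem_insert_of_mem ha)
          exact ⟨y, hy, hya.symm⟩
        refine .blocked A b e f θ rfl (Blocked.of_eq hH hθ.1 hall hx htA) he ?_
          (hf.mono (subset_insert _ _)) hfe
        obtain ⟨y, hy, rfl⟩ := hall e heA
        exact image_subset_image (H.edge_subset y hy)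
    · obtain ⟨c, hc, h1, h2, h3⟩ := h
      refine ⟨c, hc, h1, h2, fun b hb hbA hbB hbc =>
        .building n e he (mem_insert_of_mem heA) (h3 b hb hbA hbB hbc) ?_⟩
      rw [card_insert_of_notMem hbA]
      omega

theorem hasDrawingStrategy (hH : IsPivot H z r g) (hk : k ≠ 0)
    (hfast : HasFastWinningStrategy (H.deleteVertex z)) : HasDrawingStrategy H .second := by
  -- This strategy only supplies default legal moves away from good positions.
  obtain ⟨s, -⟩ := id hfast
  refine hasDrawingStrategy_second_of_invariant H s
    (fun A B => Disjoint A B ∧ Good H z r g A B) ?_ ?_ ?_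
  · intro a ha
    -- The edge to be avoided is FP's first move, and the number of rounds is |E(H)| - 2.
    refine ⟨disjoint_empty_right _, .building _ a ha (mem_singleton_self a)
      (hfast.forces_avoiding hk ha) ?_⟩
    have := hH.card_deleteVertex
    rw [card_singleton]
    omega
  · exact fun A B h => h.2.safe hH h.1
  · rintro A B ⟨hAB, h⟩
    obtain ⟨c, hc, h1, h2, h3⟩ := h.step hH hk hAB
    refine ⟨c, hc, h1, h2, fun b hb hbA hbB hbc => ⟨?_, h3 b hb hbA hbB hbc⟩⟩
    rw [disjoint_insert_left, disjoint_insert_right, mem_insert, not_or]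
    exact ⟨⟨hbc, hbB⟩, h1, hAB⟩

end IsPivot

end RamseyGame

theorem theorem2 {k : ℕ} {V : Type*} [DecidableEq V] (H : RamseyGame.KGraph k V)
    (z : V) (r g : Finset V)
    (hz : z ∈ H.verts) (hdeg : H.degree z = 2) (hrg : H.incidentEdges z = {r, g})
    (hmin : ∀ u ∈ (H.deleteVertex z).verts, 3 ≤ (H.deleteVertex z).degree u)
    (hfour : ∀ u ∈ H.verts, u ≠ z → 4 ≤ H.degree u)
    (hfast : RamseyGame.HasFastWinningStrategy (H.deleteVertex z))
    (hrigid : ∀ e ∈ H.edges, ∀ e' ∈ H.edges, e ≠ e' → ∀ φ : V → V,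
      (H.deleteEdges {e, e'}).IsMonomorphism H φ →
        ∀ v ∈ (H.deleteEdges {e, e'}).verts, φ v = v)
    (hmeet : ∀ e ∈ H.edges, (e ∩ r).Nonempty ∧ (e ∩ g).Nonempty)
    (hsmall : (H.verts \ (r ∪ g)).card < k - 1) :
    RamseyGame.IsDraw H ∧ RamseyGame.HasDrawingStrategy H .second := by
  have hmem : ∀ e, e ∈ H.edges ∧ z ∈ e ↔ e = r ∨ e = g := by
    intro e
    have : e ∈ H.incidentEdges z ↔ e = r ∨ e = g := by simp [hrg]
    rwa [RamseyGame.KGraph.incidentEdges, Finset.mem_filter] at this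
  have hr := (hmem r).2 (.inl rfl)
  have hg := (hmem g).2 (.inr rfl)
  have hH : RamseyGame.IsPivot H z r g :=
    { mem := hz
      r_mem := hr.1
      g_mem := hg.1
      ne := by
        rintro rfl
        simp [RamseyGame.KGraph.degree, hrg] at hdeg
      z_mem_r := hr.2
      z_mem_g := hg.2
      eq_or := fun e he hze => (hmem e).1 ⟨he, hze⟩
      three_le := fun u hu huz => hmin u (Finset.mem_erase.2 ⟨huz, hu⟩)
      four_le := hfour
      rigid := hrigid
      meet := hmeet
      small := hsmall }
  -- The strict bound `hsmall` already forces `k ≥ 2`, hence `k ≠ 0`.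
  have hdraw := hH.hasDrawingStrategy (by omega) hfast
  refine ⟨fun P => ?_, hdraw⟩
  cases P with
  | first => exact RamseyGame.not_hasWinningStrategy_of_hasDrawingStrategy hdraw
  | second => exact RamseyGame.not_hasWinningStrategy_second H
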